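/- Let $R$ be the jump rates of an irreducible continuous-time Markov chain $\eta(t)$ on a finite set $E$ ($R(\eta,\xi)\ge 0$ for $\eta\ne\xi$, $\sum_\xi R(\eta,\xi)=0$), let $(Lh)(\eta)=\sum_\xi R(\eta,\xi)\{h(\xi)-h(\eta)\}$ be its generator, $\mu$ its stationary probability measure, and $\langle f,g\rangle_\mu=\sum_\eta\mu(\eta)f(\eta)g(\eta)$. For $F\subseteq E$ the trace of the chain on $F$ is $\eta^F(t)=\eta(\mathcal S_t)$, where $\mathcal S_t=\sup\{s\ge 0:\mathcal T_s\le t\}$ and $\mathcal T_s=\int_0^s \mathbf 1\{\eta(u)\in F\}\,du$; its jump rates are $R^F(\eta,\xi)=\lim_{t\downarrow 0}t^{-1}\mathbf P_\eta[\eta^F(t)=\xi]$, $\eta\neq\xi\in F$ (the limits exist), and for disjoint $A,D\subseteq F$ its mean jump rate from $A$ to $D$ is $$r_F(A,D)=\frac1{\mu(A)}\sum_{\eta\in A}\mu(\eta)\sum_{\xi\in D}R^F(\eta,\xi).$$ (1) Let $A_0,A_1,B$ be disjoint subsets of $E$, with $A_1,B$ non-empty, and let $F=A_0\cup A_1\cup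 B$, $r_T=r_F$. Consider $$\inf_f\sup_h\big\{2\langle f,(-L)h\rangle_\mu-\langle h,(-L)h\rangle_\mu\big\},$$ where $f:E\to\mathbb R$ ranges over the functions equal to $1$ on $A_1$, equal to $0$ on $A_0$ and constant on $B$, and $h:E\to\mathbb R$ over the functions equal to $0$ on $A_0$, constant on $A_1$ and constant on $B$. Then $r_T(B,A_0)+r_T(B,A_1)>0$, and there are an $f$ attaining the infimum and an $h$ attaining the supremum for this $f$ such that $$h(\eta)=\frac{r_T(B,A_1)}{r_T(B,A_0)+r_T(B,A_1)}\quad\text{for all }\eta\in B.$$ If $A_0\neq\varnothing$, this optimal pair $(f,h)$ is unique. If the linear term is written $2\langle f,Lh\rangle_\mu$ instead, then $(f,h)$ is an optimal pair if and only if $(f,-h)$ is one for the problem above. (2) Let $\mathcal E^1,\dots,\mathcal E^\kappa$, $\kappa\ge2$, be disjoint non-empty subsets of $E$, $\mathcal E=\bigcup_z\mathcal E^z$, $x\neq y$, and write $r(\mathcal E^x,\mathcal E^z)=r_{\mathcal E}(\mathcal E^x,\mathcal E^z)$. In the problem of (1) with $B=\mathcal E^x$, $A_1=\mathcal E^y$,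 $A_0=\mathcal E\setminus(\mathcal E^x\cup\mathcal E^y)$ one has $\sum_{z\ne x}r(\mathcal E^x,\mathcal E^z)>0$, and there is an optimal pair $(f,h)$ with $$h(\eta)=\frac{r(\mathcal E^x,\mathcal E^y)}{\sum_{z\neq x}r(\mathcal E^x,\mathcal E^z)}\quad\text{for all }\eta\in\mathcal E^x;$$ if $\kappa\ge 3$ it is the only optimal pair. -/

import Mathlib

open MeasureTheory ProbabilityTheory

noncomputable section

/-- Jump rates of a continuous-time Markov chain on the finite set `E`. -/
structure RateMatrix (E : Type*) [Fintype E] where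
  rate : E → E → ℝ
  rate_nonneg : ∀ η ξ, η ≠ ξ → 0 ≤ rate η ξ
  row_sum : ∀ η, ∑ ξ, rate η ξ = 0

namespace RateMatrix

variable {E : Type*} [Fintype E]

/-- Every state can be reached from every other one by jumps of positive rate. -/
def Irreducible (R : RateMatrix E) : Prop :=
  ∀ η ξ, Relation.ReflTransGen (fun a b => a ≠ b ∧ 0 < R.rate a b) η ξ

/-- `μ` is a stationary probability measure. -/
def IsStationary (R : RateMatrix E) (μ : E → ℝ) : Prop :=
  (∀ η, 0 ≤ μ η) ∧ ∑ η, μ η = 1 ∧ ∀ ξ, ∑ η, μ η * R.rate η ξ = 0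

/-- The generator `L`. -/
def gen (R : RateMatrix E) (h : E → ℝ) (η : E) : ℝ :=
  ∑ ξ, R.rate η ξ * (h ξ - h η)

/-- The holding rate `λ(η) = -R(η, η)`. -/
def hold (R : RateMatrix E) (η : E) : ℝ := -R.rate η η

variable [DecidableEq E]

theorem sum_erase (R : RateMatrix E) (η : E) :
    ∑ ξ, (if ξ = η then 0 else R.rate η ξ) = R.hold η := by
  have h := R.row_sum η
  rw [← Finset.add_sum_erase _ _ (Finset.mem_univ η)] at h ⊢
  have h2 : ∑ ξ ∈ Finset.univ.erase η, (if ξ = η then 0 else R.rate η ξ)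
      = ∑ ξ ∈ Finset.univ.erase η, R.rate η ξ :=
    Finset.sum_congr rfl fun x hx => by simp [Finset.ne_of_mem_erase hx]
  rw [h2]
  simp only [if_true, hold]
  linarith

theorem sum_jump (R : RateMatrix E) (η : E) (hη : 0 < R.hold η) :
    ∑ ξ, (if ξ = η then 0 else ENNReal.ofReal (R.rate η ξ / R.hold η)) = 1 := by
  have h1 : ∀ ξ, (if ξ = η then 0 else ENNReal.ofReal (R.rate η ξ / R.hold η))
      = ENNReal.ofReal ((if ξ = η then 0 else R.rate η ξ) / R.hold η) := by
    intro ξ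
    split_ifs <;> simp
  simp_rw [h1]
  rw [← ENNReal.ofReal_sum_of_nonneg, ← Finset.sum_div, R.sum_erase, div_self hη.ne',
    ENNReal.ofReal_one]
  intro ξ _
  split_ifs with h
  · simp
  · exact div_nonneg (R.rate_nonneg _ _ (Ne.symm h)) hη.le

/-- Law of the state after a jump from `η`: `p(η, ξ) = R(η, ξ) / λ(η)` for `ξ ≠ η`
(an absorbing state is kept for ever). -/
def jumpPMF (R : RateMatrix E) (η : E) : PMF E :=
  if hη : 0 < R.hold η then
    PMF.ofFintype (fun ξ => if ξ = η then 0 else ENNReal.ofReal (R.rate η ξ / R.hold η))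
      (R.sum_jump η hη)
  else PMF.pure η

variable [MeasurableSpace E] [MeasurableSingletonClass E]

/-- The jump probabilities as a kernel. -/
def jumpKernel (R : RateMatrix E) : Kernel E E :=
  Kernel.ofFunOfCountable fun η => (R.jumpPMF η).toMeasure

instance (R : RateMatrix E) : IsMarkovKernel R.jumpKernel :=
  ⟨fun η => by
    change IsProbabilityMeasure (R.jumpPMF η).toMeasure
    infer_instance⟩

/-- Law of the `(n+1)`-st state of the jump chain given the states number `0, …, n`. -/
def stepKernel (R : RateMatrix E) (n : ℕ) : Kernel (Finset.Iic n → E) E :=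
  R.jumpKernel.comap (fun y => y ⟨n, Finset.mem_Iic.2 le_rfl⟩) (measurable_pi_apply _)

instance (R : RateMatrix E) (n : ℕ) : IsMarkovKernel (R.stepKernel n) := by
  unfold stepKernel
  infer_instance

/-- The law `P_η` of the chain started at `η`. A sample point is a pair `(Y, e)`, where
`Y` is the jump chain started at `η`, and `e` is an independent sequence of independent
exponential variables of mean one. -/
def pathLaw (R : RateMatrix E) (η : E) : Measure ((ℕ → E) × (ℕ → ℝ)) :=
  (Kernel.traj (X := fun _ => E) R.stepKernel 0 fun _ => η).prod
    (Measure.infinitePi fun _ => expMeasure 1)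

/-- The time of the `n`-th jump: the `k`-th visited state `Y k` is held for the exponential
time `e k / λ(Y k)`. -/
def jumpTime (R : RateMatrix E) (ω : (ℕ → E) × (ℕ → ℝ)) (n : ℕ) : ℝ :=
  ∑ k ∈ Finset.range n, ω.2 k / R.hold (ω.1 k)

/-- The state `η(t)` of the chain at time `t`. -/
def state (R : RateMatrix E) (ω : (ℕ → E) × (ℕ → ℝ)) (t : ℝ) : E :=
  ω.1 (sInf {n : ℕ | t < R.jumpTime ω (n + 1)})

/-- The time `𝒯_t` spent on `F` up to time `t`. -/
def timeOn (R : RateMatrix E) (F : Finset E) (ω : (ℕ → E) × (ℕ → ℝ)) (t : ℝ) : ℝ :=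
  ∫ s in (0 : ℝ)..t, if R.state ω s ∈ F then 1 else 0

/-- The generalized inverse `𝒮_t` of `𝒯_t`. -/
def clock (R : RateMatrix E) (F : Finset E) (ω : (ℕ → E) × (ℕ → ℝ)) (t : ℝ) : ℝ :=
  sSup {s : ℝ | 0 ≤ s ∧ R.timeOn F ω s ≤ t}

/-- The trace of the chain on `F`: `η^F(t) = η(𝒮_t)`. -/
def trace (R : RateMatrix E) (F : Finset E) (ω : (ℕ → E) × (ℕ → ℝ)) (t : ℝ) : E :=
  R.state ω (R.clock F ω t)

/-- The probability `P_η[η^F(t) = ξ]`. -/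
def traceProb (R : RateMatrix E) (F : Finset E) (η ξ : E) (t : ℝ) : ℝ :=
  (R.pathLaw η).real {ω | R.trace F ω t = ξ}

/-- The rate `R^F(η, ξ)` at which the trace on `F` jumps from `η` to `ξ`, `η ≠ ξ`: the right
derivative at time zero of its transition probability. -/
def traceRate (R : RateMatrix E) (F : Finset E) (η ξ : E) : ℝ :=
  derivWithin (R.traceProb F η ξ) (Set.Ici 0) 0

/-- The mean rate `r_F(A, D)` at which the trace on `F` jumps from `A` to `D`. -/
def meanRate (R : RateMatrix E) (μ : E → ℝ) (F A D : Finset E) : ℝ :=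
  (∑ η ∈ A, μ η)⁻¹ * ∑ η ∈ A, μ η * ∑ ξ ∈ D, R.traceRate F η ξ

end RateMatrix

/-- The scalar product of `L²(μ)`. -/
def scal {E : Type*} [Fintype E] (μ f g : E → ℝ) : ℝ := ∑ η, μ η * (f η * g η)

/-- The functional `2 ⟨f, (-L) h⟩ - ⟨h, (-L) h⟩`. -/
def energy {E : Type*} [Fintype E] (R : RateMatrix E) (μ f h : E → ℝ) : ℝ :=
  2 * scal μ f (-R.gen h) - scal μ h (-R.gen h)

/-- The functional `2 ⟨f, L h⟩ - ⟨h, (-L) h⟩`. -/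
def energyNeg {E : Type*} [Fintype E] (R : RateMatrix E) (μ f h : E → ℝ) : ℝ :=
  2 * scal μ f (R.gen h) - scal μ h (-R.gen h)

/-- The functions equal to `1` on `A₁`, to `0` on `A₀`, and constant on `B`. -/
def classF {E : Type*} (A₀ A₁ B : Finset E) : Set (E → ℝ) :=
  {f | (∀ η ∈ A₁, f η = 1) ∧ (∀ η ∈ A₀, f η = 0) ∧ ∃ c, ∀ η ∈ B, f η = c}

/-- The functions equal to `0` on `A₀`, constant on `A₁`, and constant on `B`. -/
def classH {E : Type*} (A₀ A₁ B : Finset E) : Set (E → ℝ) :=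
  {h | (∀ η ∈ A₀, h η = 0) ∧ (∃ c, ∀ η ∈ A₁, h η = c) ∧ ∃ c, ∀ η ∈ B, h η = c}

/-- `f` attains the infimum in `inf_{f ∈ 𝓕} sup_{h ∈ 𝓗} J f h`, and `h` attains the supremum
for this `f`. -/
def IsOptimalPair {E : Type*} (J : (E → ℝ) → (E → ℝ) → ℝ) (𝓕 𝓗 : Set (E → ℝ))
    (f h : E → ℝ) : Prop :=
  f ∈ 𝓕 ∧ (∀ f' ∈ 𝓕, ⨆ g ∈ 𝓗, (J f g : EReal) ≤ ⨆ g ∈ 𝓗, (J f' g : EReal)) ∧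
    h ∈ 𝓗 ∧ ∀ g ∈ 𝓗, J f g ≤ J f h

end

/-!
**Variational part.** Write `D(f, h) = ⟨f, (-L) h⟩`. Its diagonal is the Dirichlet form, which by
irreducibility is definite on functions vanishing at a point. Hence a finite-dimensional
Lax–Milgram lemma (`LinearMap.exists_forall_apply_eq_of_definite`) applies on the space `W` of
functions that vanish on `A₀ ∪ A₁` and are constant on `B`, without any symmetry of `D`. It gives
a function `u`, equal to `1` on `A₁` and to `0` on `A₀`, with `D(w, u) = 0` for `w` in `W`, and
then a function `f` in `u + W` with `2 D(f, k) = D(u, k) + D(k, u)` for all admissible `k`.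
Completing the square, `energy f k = D(u, u) - D(u - k, u - k)`, while `energy f' u = D(u, u)` for
every admissible `f'`. So `(f, u)` is an optimal pair. If `A₀` is non-empty, `D` is definite on
all the admissible `k`; strict concavity then gives the uniqueness of the maximiser, and the
first-order condition tested with `f' - f` gives the uniqueness of the minimiser.

**Value on `B`.** The condition `D(w, u) = 0` says that `L u = 0` off `F = A₀ ∪ A₁ ∪ B` and that
`u` has no flux out of `B`. The trace on `F` has a generator that coincides with `L` on such
functions (`RateMatrix.gen_eq_sum_traceRate`), so the flux condition reads
`r(B, A₀) (0 - u(B)) + r(B, A₁) (1 - u(B)) = 0`. The same identity for the harmonic extension of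
`1_B` shows `r(B, A₀) + r(B, A₁) > 0`.

**Jump rates of the trace.** Let `q(η, ξ)` be the probability that the jump chain started at `η`
first returns to `F` at `ξ`. Up to an event of probability `O(t ^ 2)`, on which the holding times
at `η` and at the first return to `F` are both short, the trace is at `ξ ≠ η` at time `t` if and
only if the first holding time is at most `t` and the return takes place at `ξ`
(`RateMatrix.abs_traceProb_sub_le`). As the jump chain and the holding variables are independent,
this gives `R^F(η, ξ) = λ(η) q(η, ξ)`. That `q(η, ·)` integrates functions with `L u = 0` off `F`
correctly is optional stopping, by the Markov property of the jump chain; the return time is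
finite because the solution of `L w = -1` off `F` is a Lyapunov function.
-/

/-! ### The Dirichlet form -/

namespace RateMatrix

variable {E : Type*} [Fintype E]

theorem gen_eq_sum (R : RateMatrix E) (h : E → ℝ) (η : E) :
    R.gen h η = ∑ ξ, R.rate η ξ * h ξ := by
  simp only [gen, mul_sub, Finset.sum_sub_distrib, ← Finset.sum_mul, R.row_sum, zero_mul, sub_zero]

/-- The bilinear form `(f, h) ↦ ⟨f, (-L) h⟩`. -/
noncomputable def form (R : RateMatrix E) (μ : E → ℝ) : (E → ℝ) →ₗ[ℝ] (E → ℝ) →ₗ[ℝ] ℝ :=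
  LinearMap.mk₂ ℝ (fun f h => scal μ f (-R.gen h))
    (fun f g h => by
      simp only [scal, Pi.add_apply, ← Finset.sum_add_distrib]
      exact Finset.sum_congr rfl fun _ _ => by ring)
    (fun c f h => by
      simp only [scal, Pi.smul_apply, smul_eq_mul, Finset.mul_sum]
      exact Finset.sum_congr rfl fun _ _ => by ring)
    (fun f g h => by
      simp only [scal, Pi.neg_apply, gen_eq_sum, Pi.add_apply, mul_add, neg_add,
        Finset.sum_add_distrib])
    (fun c f h => by
      simp only [scal, Pi.neg_apply, gen_eq_sum, Pi.smul_apply, smul_eq_mul, Finset.mul_sum,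
        mul_neg, Finset.sum_neg_distrib]
      congr 1
      exact Finset.sum_congr rfl fun _ _ => Finset.sum_congr rfl fun _ _ => by ring)

theorem form_apply (R : RateMatrix E) (μ f h : E → ℝ) :
    R.form μ f h = ∑ η, μ η * f η * -R.gen h η := by
  simp [form, scal, mul_assoc]

theorem energy_eq_form (R : RateMatrix E) (μ f h : E → ℝ) :
    energy R μ f h = 2 * R.form μ f h - R.form μ h h := rfl

theorem energyNeg_eq_energy_neg (R : RateMatrix E) (μ f h : E → ℝ) :
    energyNeg R μ f h = energy R μ f (-h) := by
  have h1 : scal μ f (R.gen h) = - R.form μ f h := by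
    simp [form_apply, scal, mul_assoc]
  have h2 : scal μ h (-R.gen h) = R.form μ h h := rfl
  rw [energyNeg, h1, h2, energy_eq_form]
  simp

theorem IsStationary.pos {R : RateMatrix E} {μ : E → ℝ} (hμ : R.IsStationary μ)
    (hR : R.Irreducible) (η : E) : 0 < μ η := by
  obtain ⟨h0, h1, h2⟩ := hμ
  obtain ⟨ζ, hζ⟩ : ∃ ζ, 0 < μ ζ := by
    by_contra! h
    have := Finset.sum_nonpos fun ζ (_ : ζ ∈ Finset.univ) => h ζ
    linarith
  induction hR ζ η with
  | refl => exact hζ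
  | @tail a b _ hab ih =>
    refine (h0 b).lt_of_ne fun hb => ?_
    have hnn : ∀ c ∈ Finset.univ, 0 ≤ μ c * R.rate c b := fun c _ => by
      rcases eq_or_ne c b with rfl | hc
      · simp [← hb]
      · exact mul_nonneg (h0 c) (R.rate_nonneg _ _ hc)
    have := (Finset.sum_eq_zero_iff_of_nonneg hnn).1 (h2 b) a (Finset.mem_univ a)
    exact (mul_pos ih hab.2).ne' this

/-- By stationarity the diagonal of the form is a sum of squares, without reversibility. -/
theorem IsStationary.form_self {R : RateMatrix E} {μ : E → ℝ} (hμ : R.IsStationary μ)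
    (k : E → ℝ) :
    R.form μ k k = 2⁻¹ * ∑ η, ∑ ξ, μ η * R.rate η ξ * (k ξ - k η) ^ 2 := by
  have h1 : ∀ η, ∑ ξ, μ η * R.rate η ξ * (k ξ - k η) ^ 2
      = ∑ ξ, μ η * R.rate η ξ * k ξ ^ 2 + 2 * (μ η * k η * -R.gen k η) := fun η => by
    have h2 : ∑ ξ, μ η * k η ^ 2 * R.rate η ξ = 0 := by rw [← Finset.mul_sum, R.row_sum, mul_zero]
    rw [← sub_eq_zero, ← h2, gen_eq_sum, mul_neg, mul_neg, Finset.mul_sum, Finset.mul_sum,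
      ← sub_sub, sub_neg_eq_add, ← Finset.sum_sub_distrib, ← Finset.sum_add_distrib]
    exact Finset.sum_congr rfl fun _ _ => by ring
  have h3 : ∑ η, ∑ ξ, μ η * R.rate η ξ * k ξ ^ 2 = 0 := by
    rw [Finset.sum_comm]
    refine Finset.sum_eq_zero fun ξ _ => ?_
    rw [← Finset.sum_mul, hμ.2.2, zero_mul]
  simp only [h1, Finset.sum_add_distrib, h3, zero_add, ← Finset.mul_sum, form_apply]
  ring

theorem IsStationary.form_term_nonneg {R : RateMatrix E} {μ : E → ℝ} (hμ : R.IsStationary μ)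
    (k : E → ℝ) (η ξ : E) : 0 ≤ μ η * R.rate η ξ * (k ξ - k η) ^ 2 := by
  rcases eq_or_ne η ξ with rfl | h
  · simp
  · exact mul_nonneg (mul_nonneg (hμ.1 η) (R.rate_nonneg _ _ h)) (sq_nonneg _)

theorem IsStationary.form_self_nonneg {R : RateMatrix E} {μ : E → ℝ} (hμ : R.IsStationary μ)
    (k : E → ℝ) : 0 ≤ R.form μ k k := by
  rw [hμ.form_self]
  exact mul_nonneg (by norm_num) (Finset.sum_nonneg fun η _ => Finset.sum_nonneg fun ξ _ =>
    hμ.form_term_nonneg k η ξ)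

theorem IsStationary.eq_of_form_self_eq_zero {R : RateMatrix E} {μ : E → ℝ}
    (hμ : R.IsStationary μ) (hR : R.Irreducible) {k : E → ℝ} (hk : R.form μ k k = 0) (η ξ : E) :
    k η = k ξ := by
  have hk' : ∑ η, ∑ ξ, μ η * R.rate η ξ * (k ξ - k η) ^ 2 = 0 := by
    rw [hμ.form_self] at hk
    linarith
  rw [Finset.sum_eq_zero_iff_of_nonneg fun η _ => Finset.sum_nonneg fun ξ _ =>
    hμ.form_term_nonneg k η ξ] at hk'
  induction hR η ξ with
  | refl => rfl
  | @tail a b _ hab ih =>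
    have h1 := hk' a (Finset.mem_univ a)
    rw [Finset.sum_eq_zero_iff_of_nonneg fun ξ _ => hμ.form_term_nonneg k a ξ] at h1
    have h2 := h1 b (Finset.mem_univ b)
    have h3 : (k b - k a) ^ 2 = 0 :=
      (mul_eq_zero.1 h2).resolve_left (mul_pos (hμ.pos hR a) hab.2).ne'
    rw [ih]
    linarith [pow_eq_zero_iff (two_ne_zero) |>.1 h3]

/-- On functions vanishing at a given point the Dirichlet form is definite. -/
theorem IsStationary.eq_zero_of_form_self_eq_zero {R : RateMatrix E} {μ : E → ℝ}
    (hμ : R.IsStationary μ) (hR : R.Irreducible) {k : E → ℝ} (hk : R.form μ k k = 0) {η : E}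
    (hη : k η = 0) : k = 0 := by
  funext ξ
  rw [hμ.eq_of_form_self_eq_zero hR hk ξ η, hη, Pi.zero_apply]

end RateMatrix

/-- Finite-dimensional Lax–Milgram lemma: a bilinear form that is definite on a subspace `V`
represents every linear functional on `V`. -/
theorem LinearMap.exists_forall_apply_eq_of_definite {M : Type*} [AddCommGroup M] [Module ℝ M]
    [FiniteDimensional ℝ M] (b : M →ₗ[ℝ] M →ₗ[ℝ] ℝ) (V : Submodule ℝ M)
    (hV : ∀ v ∈ V, b v v = 0 → v = 0) (ℓ : M →ₗ[ℝ] ℝ) : ∃ w ∈ V, ∀ v ∈ V, b w v = ℓ v := by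
  let T : V →ₗ[ℝ] Module.Dual ℝ V := b.compl₁₂ V.subtype V.subtype
  have hT : Function.Injective T := by
    rw [← LinearMap.ker_eq_bot, LinearMap.ker_eq_bot']
    intro v hv
    have h1 : b v v = 0 := LinearMap.congr_fun hv v
    exact Subtype.ext (hV v v.2 h1)
  have hS : Function.Surjective T :=
    (LinearMap.injective_iff_surjective_of_finrank_eq_finrank
      (Subspace.dual_finrank_eq (K := ℝ) (V := V)).symm).1 hT
  obtain ⟨w, hw⟩ := hS (ℓ.comp V.subtype)
  exact ⟨w, w.2, fun v hv => LinearMap.congr_fun hw ⟨v, hv⟩⟩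

/-! ### The variational problem -/

/-- The functions that vanish on `Z` and are constant on `B`. -/
def vanishConst {E : Type*} (Z B : Finset E) : Submodule ℝ (E → ℝ) where
  carrier := {w | (∀ η ∈ Z, w η = 0) ∧ ∃ c, ∀ η ∈ B, w η = c}
  zero_mem' := ⟨fun _ _ => rfl, 0, fun _ _ => rfl⟩
  add_mem' := by
    rintro v w ⟨hv, c, hc⟩ ⟨hw, d, hd⟩
    exact ⟨fun η h => by simp [hv η h, hw η h], c + d, fun η h => by simp [hc η h, hd η h]⟩
  smul_mem' := by
    rintro a v ⟨hv, c, hc⟩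
    exact ⟨fun η h => by simp [hv η h], a * c, fun η h => by simp [hc η h]⟩

theorem sub_mem_classH {E : Type*} {A₀ A₁ B : Finset E} {g h : E → ℝ}
    (hg : g ∈ classH A₀ A₁ B) (hh : h ∈ classH A₀ A₁ B) : g - h ∈ classH A₀ A₁ B := by
  obtain ⟨hg0, ⟨c, hc⟩, d, hd⟩ := hg
  obtain ⟨hh0, ⟨c', hc'⟩, d', hd'⟩ := hh
  exact ⟨fun η h => by simp [hg0 η h, hh0 η h], ⟨c - c', fun η h => by simp [hc η h, hc' η h]⟩,
    d - d', fun η h => by simp [hd η h, hd' η h]⟩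

theorem smul_mem_classH {E : Type*} {A₀ A₁ B : Finset E} (a : ℝ) {g : E → ℝ}
    (hg : g ∈ classH A₀ A₁ B) : a • g ∈ classH A₀ A₁ B := by
  obtain ⟨hg0, ⟨c, hc⟩, d, hd⟩ := hg
  exact ⟨fun η h => by simp [hg0 η h], ⟨a * c, fun η h => by simp [hc η h]⟩,
    a * d, fun η h => by simp [hd η h]⟩

theorem neg_mem_classH_iff {E : Type*} {A₀ A₁ B : Finset E} {g : E → ℝ} :
    -g ∈ classH A₀ A₁ B ↔ g ∈ classH A₀ A₁ B :=
  ⟨fun h => by simpa using smul_mem_classH (-1) h, fun h => by simpa using smul_mem_classH (-1) h⟩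

theorem classF_subset_classH {E : Type*} {A₀ A₁ B : Finset E} :
    classF A₀ A₁ B ⊆ classH A₀ A₁ B := fun _ h => ⟨h.2.1, ⟨1, h.1⟩, h.2.2⟩

namespace RateMatrix

variable {E : Type*} [Fintype E]

/-- Weak form of the Dirichlet problem for the generator. -/
theorem IsStationary.exists_dirichlet {R : RateMatrix E} {μ : E → ℝ} (hμ : R.IsStationary μ)
    (hR : R.Irreducible) {Z : Finset E} (hZ : Z.Nonempty) (B : Finset E) (g : E → ℝ)
    (ℓ : (E → ℝ) →ₗ[ℝ] ℝ) :
    ∃ u, u - g ∈ vanishConst Z B ∧ ∀ v ∈ vanishConst Z B, R.form μ v u = ℓ v := by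
  obtain ⟨ζ, hζ⟩ := hZ
  obtain ⟨w, hw, h⟩ := (R.form μ).flip.exists_forall_apply_eq_of_definite (vanishConst Z B)
    (fun v hv h => hμ.eq_zero_of_form_self_eq_zero hR h (hv.1 ζ hζ)) (ℓ - (R.form μ).flip g)
  refine ⟨g + w, by simpa using hw, fun v hv => ?_⟩
  have := h v hv
  simp only [LinearMap.flip_apply, LinearMap.sub_apply] at this
  rw [map_add, this]
  ring

/-- A weak solution `u` of `-L u = ψ` is a solution outside the sets on which
the test functions are prescribed. -/
theorem IsStationary.gen_eq_of_weak {R : RateMatrix E} {μ : E → ℝ} (hμ : R.IsStationary μ)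
    (hR : R.Irreducible) {Z B : Finset E} {u ψ : E → ℝ}
    (h : ∀ v ∈ vanishConst Z B, R.form μ v u = scal μ v ψ) {η : E} (hZ : η ∉ Z) (hB : η ∉ B) :
    R.gen u η = -ψ η := by
  classical
  have h1 := h (Pi.single η 1) ⟨fun ξ hξ => by
      rw [Pi.single_apply, if_neg]; rintro rfl; exact hZ hξ, 0, fun ξ hξ => by
      rw [Pi.single_apply, if_neg]; rintro rfl; exact hB hξ⟩
  simp only [form_apply, scal, Pi.single_apply, mul_ite, ite_mul, mul_one, mul_zero, zero_mul,
    one_mul, Finset.sum_ite_eq', Finset.mem_univ, if_true] at h1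
  have := mul_left_cancel₀ (hμ.pos hR η).ne' h1
  linarith

/-- A function with vanishing form against the functions constant on `B` has no flux out
of `B`. -/
theorem sum_gen_eq_zero_of_weak {R : RateMatrix E} {μ : E → ℝ} {Z B : Finset E}
    (hZB : Disjoint Z B) {u : E → ℝ} (h : ∀ v ∈ vanishConst Z B, R.form μ v u = 0) :
    ∑ η ∈ B, μ η * R.gen u η = 0 := by
  classical
  have h1 := h (fun η => if η ∈ B then 1 else 0) ⟨fun η hη => by
    simp [Finset.disjoint_left.1 hZB hη], 1, fun η hη => by simp [hη]⟩
  simpa [form_apply, mul_ite, ite_mul, Finset.sum_ite_mem] using h1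

/-- The maximiser `h` and a minimiser `f`: `u` is the weak solution of the problem `L u = 0`
with values `1` on `A₁`, `0` on `A₀` and no flux out of the constant set `B`, and `f`
symmetrises the form at `u`. -/
theorem IsStationary.exists_saddle [DecidableEq E] {R : RateMatrix E} {μ : E → ℝ}
    (hμ : R.IsStationary μ) (hR : R.Irreducible) {A₀ A₁ B : Finset E} (h01 : Disjoint A₀ A₁)
    (h1B : Disjoint A₁ B) (h1 : A₁.Nonempty) :
    ∃ f u, f ∈ classF A₀ A₁ B ∧ u ∈ classF A₀ A₁ B ∧
      (∀ w ∈ vanishConst (A₀ ∪ A₁) B, R.form μ w u = 0) ∧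
      ∀ k ∈ classH A₀ A₁ B, 2 * R.form μ f k = R.form μ u k + R.form μ k u := by
  have hZ : (A₀ ∪ A₁).Nonempty := h1.mono Finset.subset_union_right
  obtain ⟨u, ⟨hu, c, hc⟩, hw⟩ := hμ.exists_dirichlet hR hZ B
    (fun η => if η ∈ A₁ then 1 else 0) 0
  have hu' : u ∈ classF A₀ A₁ B := by
    refine ⟨fun η hη => ?_, fun η hη => ?_, c, fun η hη => ?_⟩
    · have := hu η (Finset.mem_union_right _ hη)
      simp only [Pi.sub_apply, hη, if_true] at this
      linarith
    · have := hu η (Finset.mem_union_left _ hη)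
      simp only [Pi.sub_apply, Finset.disjoint_left.1 h01 hη, if_false] at this
      linarith
    · have := hc η hη
      simp only [Pi.sub_apply, Finset.disjoint_right.1 h1B hη, if_false] at this
      linarith
  obtain ⟨ζ, hζ⟩ := hZ
  obtain ⟨w, hwV, hw2⟩ := (R.form μ).exists_forall_apply_eq_of_definite (vanishConst (A₀ ∪ A₁) B)
    (fun v hv h => hμ.eq_zero_of_form_self_eq_zero hR h (hv.1 ζ hζ))
    ((2⁻¹ : ℝ) • ((R.form μ).flip u - R.form μ u))
  have hw0 : ∀ v ∈ vanishConst (A₀ ∪ A₁) B, R.form μ v u = 0 := hw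
  refine ⟨u + w, u, ?_, hu', hw0, ?_⟩
  · obtain ⟨b, hb⟩ := hwV.2
    obtain ⟨b', hb'⟩ := hu'.2.2
    exact ⟨fun η hη => by simp [hu'.1 η hη, hwV.1 η (Finset.mem_union_right _ hη)],
      fun η hη => by simp [hu'.2.1 η hη, hwV.1 η (Finset.mem_union_left _ hη)],
      b' + b, fun η hη => by simp [hb η hη, hb' η hη]⟩
  · rintro k hk
    -- subtracting a multiple of `u` makes `k` vanish on `A₁`
    obtain ⟨a, ha⟩ := hk.2.1
    have hv : k - a • u ∈ vanishConst (A₀ ∪ A₁) B := by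
      have hmem := sub_mem_classH hk (smul_mem_classH a (classF_subset_classH hu'))
      refine ⟨fun η hη => ?_, hmem.2.2⟩
      rcases Finset.mem_union.1 hη with h | h
      · exact hmem.1 η h
      · simp [ha η h, hu'.1 η h]
    have h2 := hw2 _ hv
    have h3 := hw0 w hwV
    simp only [map_sub, map_smul, LinearMap.smul_apply, LinearMap.sub_apply, LinearMap.flip_apply,
      smul_eq_mul, h3, map_add, LinearMap.add_apply] at h2 ⊢
    linarith

/-- Completing the square at `u`. -/
theorem energy_saddle {R : RateMatrix E} {μ : E → ℝ} {A₀ A₁ B : Finset E}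
    {f u : E → ℝ}
    (hf : ∀ k ∈ classH A₀ A₁ B, 2 * R.form μ f k = R.form μ u k + R.form μ k u)
    {g : E → ℝ} (hg : g ∈ classH A₀ A₁ B) :
    energy R μ f g = R.form μ u u - R.form μ (u - g) (u - g) := by
  rw [energy_eq_form, hf g hg]
  simp only [map_sub, LinearMap.sub_apply]
  ring

/-- The value of the functional at `u` is the same for all admissible `f`. -/
theorem energy_classF_eq [DecidableEq E] {R : RateMatrix E} {μ : E → ℝ} {A₀ A₁ B : Finset E}
    {f u : E → ℝ} (hu : u ∈ classF A₀ A₁ B)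
    (hw : ∀ w ∈ vanishConst (A₀ ∪ A₁) B, R.form μ w u = 0) (hf : f ∈ classF A₀ A₁ B) :
    energy R μ f u = R.form μ u u := by
  have h := sub_mem_classH (classF_subset_classH hf) (classF_subset_classH hu)
  have h1 := hw (f - u) ⟨fun η hη => by
    rcases Finset.mem_union.1 hη with h' | h'
    · exact h.1 η h'
    · simp [hf.1 η h', hu.1 η h'], h.2.2⟩
  rw [map_sub, LinearMap.sub_apply] at h1
  rw [energy_eq_form]
  linarith

theorem IsStationary.isOptimalPair_saddle [DecidableEq E] {R : RateMatrix E} {μ : E → ℝ}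
    (hμ : R.IsStationary μ) {A₀ A₁ B : Finset E} {f u : E → ℝ} (hf : f ∈ classF A₀ A₁ B)
    (hu : u ∈ classF A₀ A₁ B) (hw : ∀ w ∈ vanishConst (A₀ ∪ A₁) B, R.form μ w u = 0)
    (hfu : ∀ k ∈ classH A₀ A₁ B, 2 * R.form μ f k = R.form μ u k + R.form μ k u) :
    IsOptimalPair (energy R μ) (classF A₀ A₁ B) (classH A₀ A₁ B) f u := by
  have hle : ∀ g ∈ classH A₀ A₁ B, energy R μ f g ≤ R.form μ u u := fun g hg => by
    rw [energy_saddle hfu hg]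
    linarith [hμ.form_self_nonneg (u - g)]
  have huH := classF_subset_classH hu
  refine ⟨hf, fun f' hf' => ?_, huH, fun g hg => ?_⟩
  · calc ⨆ g ∈ classH A₀ A₁ B, (energy R μ f g : EReal) ≤ (R.form μ u u : ℝ) :=
        iSup₂_le fun g hg => EReal.coe_le_coe_iff.2 (hle g hg)
      _ = (energy R μ f' u : ℝ) := by rw [energy_classF_eq hu hw hf']
      _ ≤ _ := le_iSup₂_of_le u huH le_rfl
  · rw [energy_classF_eq hu hw hf]
    exact hle g hg

/-- Two maximisers of the concave function `energy f` differ by a null vector of the Dirichlet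
form. -/
theorem form_sub_self_eq_zero_of_maximal {R : RateMatrix E} {μ : E → ℝ} {A₀ A₁ B : Finset E}
    {f u h : E → ℝ} (hu : u ∈ classH A₀ A₁ B) (hh : h ∈ classH A₀ A₁ B)
    (hmax : ∀ g ∈ classH A₀ A₁ B, energy R μ f g ≤ energy R μ f u)
    (hmax' : ∀ g ∈ classH A₀ A₁ B, energy R μ f g ≤ energy R μ f h) :
    R.form μ (u - h) (u - h) ≤ 0 := by
  -- the parallelogram identity at the midpoint of `u` and `h`
  have hmid := smul_mem_classH (2⁻¹ : ℝ) (sub_mem_classH hu (neg_mem_classH_iff.2 hh))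
  have h1 := hmax _ hmid
  have h2 := hmax' u hu
  have h3 := hmax h hh
  simp only [energy_eq_form, map_sub, map_smul, LinearMap.smul_apply, LinearMap.sub_apply,
    smul_eq_mul, map_neg, LinearMap.neg_apply] at h1 h2 h3 ⊢
  linarith

/-- First-order condition at a maximiser of `energy f`. -/
theorem two_mul_form_eq_of_maximal {R : RateMatrix E} {μ : E → ℝ} {A₀ A₁ B : Finset E}
    {f u : E → ℝ} (hu : u ∈ classH A₀ A₁ B)
    (hmax : ∀ g ∈ classH A₀ A₁ B, energy R μ f g ≤ energy R μ f u) {k : E → ℝ}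
    (hk : k ∈ classH A₀ A₁ B) : 2 * R.form μ f k = R.form μ u k + R.form μ k u := by
  have key : ∀ s : ℝ, 0 ≤ R.form μ k k * (s * s)
      + (-(2 * R.form μ f k - R.form μ u k - R.form μ k u)) * s + 0 := fun s => by
    have h1 := hmax _ (sub_mem_classH hu (smul_mem_classH (-s) hk))
    simp only [energy_eq_form, map_sub, map_smul, LinearMap.smul_apply, LinearMap.sub_apply,
      smul_eq_mul] at h1
    linarith
  have := discrim_le_zero key
  rw [discrim] at this
  have h0 : -(2 * R.form μ f k - R.form μ u k - R.form μ k u) = 0 := by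
    apply pow_eq_zero_iff (two_ne_zero) |>.1
    nlinarith [sq_nonneg (-(2 * R.form μ f k - R.form μ u k - R.form μ k u))]
  linarith

theorem IsStationary.optimalPair_unique [DecidableEq E] {R : RateMatrix E} {μ : E → ℝ}
    (hμ : R.IsStationary μ) (hR : R.Irreducible) {A₀ A₁ B : Finset E} (h0 : A₀.Nonempty)
    {f u f' h' : E → ℝ} (hf : f ∈ classF A₀ A₁ B)
    (hu : u ∈ classF A₀ A₁ B) (hw : ∀ w ∈ vanishConst (A₀ ∪ A₁) B, R.form μ w u = 0)
    (hfu : ∀ k ∈ classH A₀ A₁ B, 2 * R.form μ f k = R.form μ u k + R.form μ k u)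
    (hopt : IsOptimalPair (energy R μ) (classF A₀ A₁ B) (classH A₀ A₁ B) f' h') :
    f' = f ∧ h' = u := by
  obtain ⟨ζ, hζ⟩ := h0
  obtain ⟨hf', hmin, hh', hmax⟩ := hopt
  have huH := classF_subset_classH hu
  -- `f'` has the same minimal value as `f`, hence `u` is a maximiser for `f'` as well
  have hle : ∀ g ∈ classH A₀ A₁ B, energy R μ f' g ≤ energy R μ f' u := fun g hg => by
    rw [energy_classF_eq hu hw hf', ← EReal.coe_le_coe_iff]
    refine (le_iSup₂_of_le (f := fun g _ => (energy R μ f' g : EReal)) g hg le_rfl).trans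
      ((hmin f hf).trans (iSup₂_le fun k hk => EReal.coe_le_coe_iff.2 ?_))
    rw [energy_saddle hfu hk]
    linarith [hμ.form_self_nonneg (u - k)]
  constructor
  · have hsub := sub_mem_classH (classF_subset_classH hf') (classF_subset_classH hf)
    have h1 := two_mul_form_eq_of_maximal huH hle hsub
    have h2 := hfu _ hsub
    have h3 : R.form μ (f' - f) (f' - f) = 0 := by
      rw [map_sub (R.form μ), LinearMap.sub_apply]
      linarith
    exact sub_eq_zero.1 (hμ.eq_zero_of_form_self_eq_zero hR h3 (hsub.1 ζ hζ))
  · have h1 := form_sub_self_eq_zero_of_maximal hh' huH hmax hle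
    exact sub_eq_zero.1 (hμ.eq_zero_of_form_self_eq_zero hR
      (h1.antisymm (hμ.form_self_nonneg _)) ((sub_mem_classH hh' huH).1 ζ hζ))

theorem isOptimalPair_energyNeg_iff (R : RateMatrix E) (μ : E → ℝ) (A₀ A₁ B : Finset E)
    (f h : E → ℝ) :
    IsOptimalPair (energyNeg R μ) (classF A₀ A₁ B) (classH A₀ A₁ B) f h ↔
      IsOptimalPair (energy R μ) (classF A₀ A₁ B) (classH A₀ A₁ B) f (-h) := by
  have hsup : ∀ f, ⨆ g ∈ classH A₀ A₁ B, (energy R μ f (-g) : EReal)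
      = ⨆ g ∈ classH A₀ A₁ B, (energy R μ f g : EReal) := fun f => by
    refine (Equiv.neg (E → ℝ)).iSup_congr fun g => ?_
    simp only [Equiv.neg_apply, neg_mem_classH_iff]
  simp only [IsOptimalPair, energyNeg_eq_energy_neg, hsup, neg_mem_classH_iff]
  refine and_congr_right fun _ => and_congr_right fun _ => and_congr_right fun _ =>
    ⟨fun H g hg => ?_, fun H g hg => H _ (neg_mem_classH_iff.2 hg)⟩
  simpa using H (-g) (neg_mem_classH_iff.2 hg)

end RateMatrix

/-! ### Paths and their trace -/

namespace RateMatrix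

/-- The event that the chain visits `F` after its start for the first time at the jump number
`n + 1`. -/
def returnAt {E : Type*} (F : Finset E) (n : ℕ) : Set (ℕ → E) :=
  {Y | (∀ k, 1 ≤ k → k ≤ n → Y k ∉ F) ∧ Y (n + 1) ∈ F}

theorem measurableSet_returnAt {E : Type*} [MeasurableSpace E] [MeasurableSingletonClass E]
    (F : Finset E) (n : ℕ) : MeasurableSet (returnAt F n) := by
  have hmem : ∀ k, MeasurableSet {Y : ℕ → E | Y k ∈ F} := fun k => by
    have hk : Measurable fun Y : ℕ → E => Y k := measurable_pi_apply k
    exact hk F.measurableSet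
  simp only [returnAt, Set.ofPred_and, Set.ofPred_forall]
  exact (MeasurableSet.iInter fun k => MeasurableSet.iInter fun _ => MeasurableSet.iInter fun _ =>
    (hmem k).compl).inter (hmem (n + 1))

theorem disjoint_returnAt {E : Type*} (F : Finset E) : Pairwise (Function.onFun Disjoint (returnAt F)) := by
  refine (pairwise_disjoint_on _).2 fun m n hmn => Set.disjoint_left.2 fun Y hm hn => ?_
  exact hn.1 (m + 1) (by omega) (by omega) hm.2

/-- The event that the state of the first return to `F` is `ξ`. -/
def returnTo {E : Type*} (F : Finset E) (ξ : E) : Set (ℕ → E) :=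
  ⋃ n, returnAt F n ∩ {Y | Y (n + 1) = ξ}

theorem measurableSet_returnTo {E : Type*} [MeasurableSpace E] [MeasurableSingletonClass E]
    (F : Finset E) (ξ : E) : MeasurableSet (returnTo F ξ) :=
  MeasurableSet.iUnion fun n => (measurableSet_returnAt F n).inter <| by
    have hn : Measurable fun Y : ℕ → E => Y (n + 1) := measurable_pi_apply _
    exact hn (measurableSet_singleton ξ)

variable {E : Type*} [Fintype E]

theorem jumpTime_succ (R : RateMatrix E) (ω : (ℕ → E) × (ℕ → ℝ)) (n : ℕ) :
    R.jumpTime ω (n + 1) = R.jumpTime ω n + ω.2 n / R.hold (ω.1 n) :=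
  Finset.sum_range_succ _ _

theorem jumpTime_zero (R : RateMatrix E) (ω : (ℕ → E) × (ℕ → ℝ)) : R.jumpTime ω 0 = 0 := rfl

theorem jumpTime_strictMono {R : RateMatrix E} (hR : ∀ η, 0 < R.hold η)
    {ω : (ℕ → E) × (ℕ → ℝ)} (hω : ∀ k, 0 < ω.2 k) : StrictMono (R.jumpTime ω) :=
  strictMono_nat_of_lt_succ fun n => by
    rw [jumpTime_succ]
    exact lt_add_of_pos_right _ (div_pos (hω n) (hR _))

theorem state_eq {R : RateMatrix E} {ω : (ℕ → E) × (ℕ → ℝ)} (hJ : StrictMono (R.jumpTime ω))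
    {s : ℝ} {n : ℕ} (h1 : R.jumpTime ω n ≤ s) (h2 : s < R.jumpTime ω (n + 1)) :
    R.state ω s = ω.1 n := by
  have : IsLeast {n : ℕ | s < R.jumpTime ω (n + 1)} n := ⟨h2, fun m hm => by
    by_contra! h
    exact absurd (hJ.monotone (Nat.succ_le_of_lt h)) (not_le.2 (h1.trans_lt hm))⟩
  rw [state, this.csInf_eq]

/-- Between the jump times number `m` and `n` only the states number `m, …, n - 1` are
visited. -/
theorem exists_state_eq {R : RateMatrix E} {ω : (ℕ → E) × (ℕ → ℝ)}
    (hJ : StrictMono (R.jumpTime ω)) {s : ℝ} {m n : ℕ} (h1 : R.jumpTime ω m ≤ s)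
    (h2 : s < R.jumpTime ω n) : ∃ k, m ≤ k ∧ k < n ∧ R.state ω s = ω.1 k := by
  induction n with
  | zero => exact absurd (h1.trans_lt h2) (not_lt.2 (hJ.monotone (Nat.zero_le m)))
  | succ n ih =>
    rcases lt_or_ge s (R.jumpTime ω n) with h | h
    · obtain ⟨k, hk1, hk2, hk3⟩ := ih h
      exact ⟨k, hk1, hk2.trans n.lt_succ_self, hk3⟩
    · refine ⟨n, ?_, n.lt_succ_self, state_eq hJ h h2⟩
      by_contra! hmn
      exact absurd (h1.trans_lt h2) (not_lt.2 (hJ.monotone hmn))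

/-- The paths are measurable also past an explosion time, so the time spent on a set is never a junk
value. -/
theorem measurable_state [MeasurableSpace E] (R : RateMatrix E) (ω : (ℕ → E) × (ℕ → ℝ)) :
    Measurable (R.state ω) := by
  refine (measurable_from_nat (f := ω.1)).comp (measurable_to_countable' fun n => ?_)
  have : (fun s : ℝ => sInf {n : ℕ | s < R.jumpTime ω (n + 1)}) ⁻¹' {n}
      = {s | (s < R.jumpTime ω (n + 1) ∧ ∀ m < n, R.jumpTime ω (m + 1) ≤ s) ∨
        (n = 0 ∧ ∀ m, R.jumpTime ω (m + 1) ≤ s)} := by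
    ext s
    simp only [Set.mem_preimage, Set.mem_singleton_iff, Set.mem_ofPred_eq]
    constructor
    · rintro rfl
      by_cases hne : {n : ℕ | s < R.jumpTime ω (n + 1)}.Nonempty
      · exact Or.inl ⟨Nat.sInf_mem hne, fun m hm => not_lt.1 fun h => Nat.notMem_of_lt_sInf hm h⟩
      · rw [Set.not_nonempty_iff_eq_empty] at hne
        refine Or.inr ⟨by rw [hne, Nat.sInf_empty], fun m => not_lt.1 fun h => ?_⟩
        exact (Set.mem_empty_iff_false m).1 (hne ▸ h)
    · rintro (⟨h1, h2⟩ | ⟨rfl, h⟩)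
      · exact IsLeast.csInf_eq ⟨h1, fun m hm => by
          by_contra! hmn
          exact absurd (h2 m hmn) (not_le.2 hm)⟩
      · have : {n : ℕ | s < R.jumpTime ω (n + 1)} = ∅ :=
          Set.eq_empty_of_forall_notMem fun m hm => absurd (h m) (not_le.2 hm)
        rw [this, Nat.sInf_empty]
  rw [this]
  simp only [Set.ofPred_or, Set.ofPred_and, Set.ofPred_forall]
  refine ((measurableSet_lt measurable_id measurable_const).inter
    (MeasurableSet.iInter fun m => MeasurableSet.iInter fun _ =>
      measurableSet_le measurable_const measurable_id)).union
    ((MeasurableSet.const _).inter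
      (MeasurableSet.iInter fun m => measurableSet_le measurable_const measurable_id))

variable [DecidableEq E] [MeasurableSpace E] [MeasurableSingletonClass E]

theorem intervalIntegrable_indicator_state (R : RateMatrix E) (F : Finset E)
    (ω : (ℕ → E) × (ℕ → ℝ)) (a b : ℝ) :
    IntervalIntegrable (fun s => if R.state ω s ∈ F then (1 : ℝ) else 0) volume a b := by
  refine (intervalIntegrable_const (c := (1 : ℝ))).mono_fun ?_ (ae_of_all _ fun s => ?_)
  · refine Measurable.aestronglyMeasurable (Measurable.ite ?_ measurable_const measurable_const)
    exact R.measurable_state ω F.measurableSet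
  · dsimp only
    split_ifs <;> simp

theorem timeOn_add (R : RateMatrix E) (F : Finset E) (ω : (ℕ → E) × (ℕ → ℝ)) (s s' : ℝ) :
    R.timeOn F ω s' = R.timeOn F ω s + ∫ r in s..s', if R.state ω r ∈ F then 1 else 0 :=
  (intervalIntegral.integral_add_adjacent_intervals
    (R.intervalIntegrable_indicator_state F ω _ _)
    (R.intervalIntegrable_indicator_state F ω _ _)).symm

theorem timeOn_mono (R : RateMatrix E) (F : Finset E) (ω : (ℕ → E) × (ℕ → ℝ)) :
    Monotone (R.timeOn F ω) := fun s s' h => by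
  rw [R.timeOn_add F ω s s']
  exact le_add_of_nonneg_right
    (intervalIntegral.integral_nonneg h fun r _ => by split_ifs <;> norm_num)

theorem timeOn_eq_of_mem {R : RateMatrix E} {F : Finset E} {ω : (ℕ → E) × (ℕ → ℝ)}
    {s s' : ℝ} (h : s ≤ s') (hF : ∀ r, s ≤ r → r < s' → R.state ω r ∈ F) :
    R.timeOn F ω s' = R.timeOn F ω s + (s' - s) := by
  rw [R.timeOn_add F ω s s', intervalIntegral.integral_of_le h, integral_Ioc_eq_integral_Ioo,
    setIntegral_congr_fun (g := fun _ => (1 : ℝ)) measurableSet_Ioo fun r hr =>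
      if_pos (hF r hr.1.le hr.2)]
  simp [h]

theorem timeOn_eq_of_notMem {R : RateMatrix E} {F : Finset E} {ω : (ℕ → E) × (ℕ → ℝ)}
    {s s' : ℝ} (h : s ≤ s') (hF : ∀ r, s ≤ r → r < s' → R.state ω r ∉ F) :
    R.timeOn F ω s' = R.timeOn F ω s := by
  rw [R.timeOn_add F ω s s', intervalIntegral.integral_of_le h, integral_Ioc_eq_integral_Ioo,
    setIntegral_congr_fun (g := fun _ => (0 : ℝ)) measurableSet_Ioo fun r hr =>
      if_neg (hF r hr.1.le hr.2)]
  simp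

/-- If the time spent on `F` before the `m`-th jump is at most `t`, and the subsequent stay at a
state of `F` makes it exceed `t`, then the trace is at this state at time `t`. -/
theorem trace_eq_of_timeOn {R : RateMatrix E} {F : Finset E} {ω : (ℕ → E) × (ℕ → ℝ)}
    (hJ : StrictMono (R.jumpTime ω)) {m : ℕ} (hm : ω.1 m ∈ F) {t : ℝ}
    (h1 : R.timeOn F ω (R.jumpTime ω m) ≤ t)
    (h2 : t < R.timeOn F ω (R.jumpTime ω m) + (R.jumpTime ω (m + 1) - R.jumpTime ω m)) :
    R.trace F ω t = ω.1 m := by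
  set J := R.jumpTime ω m with hJdef
  set a := R.timeOn F ω J with ha
  have hlin : ∀ s, J ≤ s → s ≤ R.jumpTime ω (m + 1) → R.timeOn F ω s = a + (s - J) :=
    fun s hs hs' => timeOn_eq_of_mem hs fun r hr hr' => by
      rwa [state_eq hJ hr (hr'.trans_le hs')]
  have hJ0 : 0 ≤ J := by
    rw [← R.jumpTime_zero ω]
    exact hJ.monotone (Nat.zero_le m)
  have hgr : IsGreatest {s : ℝ | 0 ≤ s ∧ R.timeOn F ω s ≤ t} (J + (t - a)) := by
    refine ⟨⟨by linarith, ?_⟩, fun s hs => ?_⟩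
    · rw [hlin _ (by linarith) (by linarith)]
      linarith
    · by_contra! hlt
      have h3 : J + (t - a) < min s (R.jumpTime ω (m + 1)) := lt_min hlt (by linarith)
      have h4 := hlin (min s (R.jumpTime ω (m + 1))) (by linarith) (min_le_right _ _)
      have h5 := R.timeOn_mono F ω (min_le_left s (R.jumpTime ω (m + 1)))
      linarith [hs.2]
  rw [trace, clock, hgr.csSup_eq]
  exact state_eq hJ (by linarith) (by linarith)

theorem trace_eq_start {R : RateMatrix E} (hR : ∀ η, 0 < R.hold η) {F : Finset E}
    {ω : (ℕ → E) × (ℕ → ℝ)} (hω : ∀ k, 0 < ω.2 k) (h0 : ω.1 0 ∈ F) {t : ℝ} (ht : 0 ≤ t)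
    (h : t < ω.2 0 / R.hold (ω.1 0)) : R.trace F ω t = ω.1 0 := by
  have h1 : R.timeOn F ω (R.jumpTime ω 0) = 0 := by simp [jumpTime_zero, timeOn]
  refine trace_eq_of_timeOn (jumpTime_strictMono hR hω) h0 (h1.trans_le ht) ?_
  rw [h1, jumpTime_succ, jumpTime_zero]
  simpa using h

theorem trace_eq_return {R : RateMatrix E} (hR : ∀ η, 0 < R.hold η) {F : Finset E}
    {ω : (ℕ → E) × (ℕ → ℝ)} (hω : ∀ k, 0 < ω.2 k) (h0 : ω.1 0 ∈ F) {n : ℕ}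
    (hn : ω.1 ∈ returnAt F n) {t : ℝ} (h1 : ω.2 0 / R.hold (ω.1 0) ≤ t)
    (h2 : t < ω.2 0 / R.hold (ω.1 0) + ω.2 (n + 1) / R.hold (ω.1 (n + 1))) :
    R.trace F ω t = ω.1 (n + 1) := by
  have hJ := jumpTime_strictMono hR hω
  have hJ1 : R.jumpTime ω 1 = ω.2 0 / R.hold (ω.1 0) := by
    rw [jumpTime_succ, jumpTime_zero, zero_add]
  have hT1 : R.timeOn F ω (R.jumpTime ω 1) = R.jumpTime ω 1 := by
    rw [timeOn_eq_of_mem (s := 0), timeOn, intervalIntegral.integral_same]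
    · ring
    · exact (hJ Nat.zero_lt_one).le
    · intro r hr hr'
      rwa [state_eq hJ (n := 0) hr hr']
  have hT2 : R.timeOn F ω (R.jumpTime ω (n + 1)) = R.jumpTime ω 1 := by
    rw [timeOn_eq_of_notMem (s := R.jumpTime ω 1), hT1]
    · exact hJ.monotone (by omega)
    · intro r hr hr'
      obtain ⟨k, hk1, hk2, hk⟩ := exists_state_eq hJ hr hr'
      rw [hk]
      exact hn.1 k hk1 (by omega)
  refine trace_eq_of_timeOn hJ hn.2 ?_ ?_
  · rwa [hT2, hJ1]
  · rwa [hT2, hJ1, jumpTime_succ R ω (n + 1), add_sub_cancel_left]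

end RateMatrix

/-! ### The jump chain and its first return to a set -/

namespace RateMatrix

variable {E : Type*} [Fintype E] [DecidableEq E]

theorem Irreducible.hold_pos {R : RateMatrix E} (hR : R.Irreducible) [Nontrivial E] (η : E) :
    0 < R.hold η := by
  obtain ⟨ξ, hξ⟩ := exists_ne η
  rcases (hR η ξ).cases_head with h | ⟨c, ⟨hne, hc⟩, -⟩
  · exact absurd h.symm hξ
  · rw [← R.sum_erase η]
    refine Finset.sum_pos' (fun ζ _ => ?_) ⟨c, Finset.mem_univ c, by rwa [if_neg hne.symm]⟩
    split_ifs with h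
    · exact le_rfl
    · exact R.rate_nonneg _ _ (Ne.symm h)

/-- The expectation of `u` after one jump from `η`. -/
noncomputable def jumpMean (R : RateMatrix E) (u : E → ℝ) (η : E) : ℝ :=
  ∑ ξ, (R.jumpPMF η ξ).toReal * u ξ

/-- The jump chain and the generator have the same harmonic functions. -/
theorem hold_mul_jumpMean {R : RateMatrix E} {η : E} (hη : 0 < R.hold η) (u : E → ℝ) :
    R.hold η * R.jumpMean u η = R.gen u η + R.hold η * u η := by
  have h1 : ∀ ξ, R.hold η * ((R.jumpPMF η ξ).toReal * u ξ)
      = R.rate η ξ * u ξ + if ξ = η then R.hold η * u η else 0 := fun ξ => by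
    rw [jumpPMF, dif_pos hη, PMF.ofFintype_apply]
    split_ifs with h
    · subst h
      simp [hold]
    · rw [ENNReal.toReal_ofReal (div_nonneg (R.rate_nonneg _ _ (Ne.symm h)) hη.le)]
      field_simp
      ring
  rw [jumpMean, Finset.mul_sum, Finset.sum_congr rfl fun ξ _ => h1 ξ, Finset.sum_add_distrib,
    gen_eq_sum]
  simp

variable [MeasurableSpace E] [MeasurableSingletonClass E]

/-- The law of the jump chain started at `η`. -/
noncomputable def chainLaw (R : RateMatrix E) (η : E) : Measure (ℕ → E) :=
  Kernel.traj (X := fun _ => E) R.stepKernel 0 fun _ => η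

instance (R : RateMatrix E) (η : E) : IsProbabilityMeasure (R.chainLaw η) := by
  unfold chainLaw
  infer_instance

theorem ae_chainLaw_zero (R : RateMatrix E) (η : E) :
    ∀ᵐ Y ∂(R.chainLaw η), Y 0 = η := by
  have h1 : (R.chainLaw η).map (Preorder.frestrictLe 0)
      = Measure.dirac (fun _ : Finset.Iic 0 => η) := by
    rw [chainLaw, Kernel.traj_map_frestrictLe_apply, Kernel.partialTraj_self, Kernel.id_apply]
  have h2 : ∀ᵐ y ∂(R.chainLaw η).map (Preorder.frestrictLe (π := fun _ => E) 0),
      y ⟨0, Finset.mem_Iic.2 le_rfl⟩ = η := by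
    rw [h1, ae_dirac_iff]
    exact measurableSet_eq_fun (measurable_pi_apply _) measurable_const
  exact ae_of_ae_map (by fun_prop) h2

/-- The Markov property of the jump chain. -/
theorem chainLaw_markov (R : RateMatrix E) (η : E) (n : ℕ) {A : Set (Finset.Iic n → E)}
    (hA : MeasurableSet A) (ξ : E) :
    (R.chainLaw η).real {Y | Preorder.frestrictLe n Y ∈ A ∧ Y (n + 1) = ξ}
      = ∑ ζ, (R.chainLaw η).real {Y | Preorder.frestrictLe n Y ∈ A ∧ Y n = ζ}
        * (R.jumpPMF ζ ξ).toReal := by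
  have hm : Measurable (fun Y : ℕ → E => (Preorder.frestrictLe (π := fun _ => E) n Y, Y (n + 1))) :=
    by fun_prop
  have h1 : (R.chainLaw η) {Y | Preorder.frestrictLe n Y ∈ A ∧ Y (n + 1) = ξ}
      = ∫⁻ Y in Preorder.frestrictLe n ⁻¹' A, R.jumpPMF (Y n) ξ ∂(R.chainLaw η) := by
    have h2 := Kernel.partialTraj_compProd_eq_map_traj (X := fun _ => E) (κ := R.stepKernel)
      (Nat.zero_le n) (x₀ := fun _ => η)
    have h3 : (R.chainLaw η) {Y | Preorder.frestrictLe n Y ∈ A ∧ Y (n + 1) = ξ}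
        = ((R.chainLaw η).map fun Y => (Preorder.frestrictLe (π := fun _ => E) n Y, Y (n + 1)))
          (A ×ˢ {ξ}) := by
      rw [Measure.map_apply hm (hA.prod (measurableSet_singleton ξ))]
      rfl
    have h4 : ∀ y : Finset.Iic n → E,
        R.stepKernel n y {ξ} = R.jumpPMF (y ⟨n, Finset.mem_Iic.2 le_rfl⟩) ξ := fun y =>
      PMF.toMeasure_apply_singleton _ _ (measurableSet_singleton ξ)
    rw [h3, chainLaw, ← h2, Measure.compProd_apply_prod hA (measurableSet_singleton ξ),
      ← Kernel.traj_map_frestrictLe_apply, setLIntegral_map hA (Kernel.measurable_coe _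
        (measurableSet_singleton ξ)) (by fun_prop)]
    simp only [h4]
    rfl
  have hA' : MeasurableSet (Preorder.frestrictLe (π := fun _ => E) n ⁻¹' A) :=
    (by fun_prop : Measurable (Preorder.frestrictLe (π := fun _ => E) n)) hA
  have h5 : ∫⁻ Y in Preorder.frestrictLe n ⁻¹' A, R.jumpPMF (Y n) ξ ∂(R.chainLaw η)
      = ∑ ζ, R.jumpPMF ζ ξ * (R.chainLaw η) {Y | Preorder.frestrictLe n Y ∈ A ∧ Y n = ζ} := by
    rw [← lintegral_map (μ := (R.chainLaw η).restrict (Preorder.frestrictLe n ⁻¹' A))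
      (f := fun ζ => R.jumpPMF ζ ξ) (measurable_of_finite _) (measurable_pi_apply n),
      lintegral_fintype]
    refine Finset.sum_congr rfl fun ζ _ => ?_
    rw [Measure.map_apply (measurable_pi_apply n) (measurableSet_singleton ζ),
      Measure.restrict_apply (measurable_pi_apply n (measurableSet_singleton ζ)), Set.inter_comm]
    rfl
  rw [measureReal_def, h1, h5, ENNReal.toReal_sum fun ζ _ =>
    ENNReal.mul_ne_top (PMF.apply_ne_top _ _) (measure_ne_top _ _)]
  exact Finset.sum_congr rfl fun ζ _ => by rw [ENNReal.toReal_mul, mul_comm, measureReal_def]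

/-- The probability that the jump chain started at `η` avoids `F` at the times `1, …, n` and
is at `ξ` at time `n + 1`. -/
noncomputable def avoidProb (R : RateMatrix E) (F : Finset E) (η : E) (n : ℕ) (ξ : E) : ℝ :=
  (R.chainLaw η).real {Y | (∀ k, 1 ≤ k → k ≤ n → Y k ∉ F) ∧ Y (n + 1) = ξ}

theorem avoidProb_markov (R : RateMatrix E) (F : Finset E) (η : E) (n : ℕ) (ξ : E) :
    R.avoidProb F η n ξ = ∑ ζ, (R.chainLaw η).real
      {Y | (∀ k, 1 ≤ k → k ≤ n → Y k ∉ F) ∧ Y n = ζ} * (R.jumpPMF ζ ξ).toReal := by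
  have hA : MeasurableSet
      {y : Finset.Iic n → E | ∀ k, ∀ h : k ∈ Finset.Iic n, 1 ≤ k → y ⟨k, h⟩ ∉ F} :=
    (Set.toFinite _).measurableSet
  have h1 : ∀ Y : ℕ → E, (Preorder.frestrictLe n Y ∈
      {y : Finset.Iic n → E | ∀ k, ∀ h : k ∈ Finset.Iic n, 1 ≤ k → y ⟨k, h⟩ ∉ F})
      ↔ ∀ k, 1 ≤ k → k ≤ n → Y k ∉ F := fun Y =>
    ⟨fun h k h1 h2 => h k (Finset.mem_Iic.2 h2) h1, fun h k h1 h2 => h k h2 (Finset.mem_Iic.1 h1)⟩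
  have := R.chainLaw_markov η n hA ξ
  simp only [h1] at this
  exact this

theorem sum_avoidProb_zero (R : RateMatrix E) (F : Finset E) (η : E) (u : E → ℝ) :
    ∑ ξ, R.avoidProb F η 0 ξ * u ξ = R.jumpMean u η := by
  have h1 : ∀ ζ, (R.chainLaw η).real {Y | (∀ k, 1 ≤ k → k ≤ 0 → Y k ∉ F) ∧ Y 0 = ζ}
      = if ζ = η then 1 else 0 := fun ζ => by
    rw [measureReal_congr (t := {_Y | ζ = η}) ?_]
    · split_ifs with h <;> simp [h]
    · filter_upwards [R.ae_chainLaw_zero η] with Y hY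
      refine propext ⟨fun h => h.2.symm.trans hY, fun h => ⟨fun k h1 h2 => by omega, ?_⟩⟩
      exact hY.trans (Eq.symm h)
  refine Finset.sum_congr rfl fun ξ _ => ?_
  rw [avoidProb_markov]
  simp only [h1, ite_mul, one_mul, zero_mul, Finset.sum_ite_eq', Finset.mem_univ, if_true]

theorem sum_avoidProb_succ (R : RateMatrix E) (F : Finset E) (η : E) (n : ℕ) (u : E → ℝ) :
    ∑ ξ, R.avoidProb F η (n + 1) ξ * u ξ = ∑ ζ ∈ Fᶜ, R.avoidProb F η n ζ * R.jumpMean u ζ := by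
  have h1 : ∀ ζ, (R.chainLaw η).real {Y | (∀ k, 1 ≤ k → k ≤ n + 1 → Y k ∉ F) ∧ Y (n + 1) = ζ}
      = if ζ ∈ Fᶜ then R.avoidProb F η n ζ else 0 := fun ζ => by
    split_ifs with h
    · rw [avoidProb]
      congr 1
      ext Y
      refine and_congr_left fun hY => ⟨fun H k h1 h2 => H k h1 (by omega), fun H k h1 h2 => ?_⟩
      rcases Nat.lt_or_ge n k with hk | hk
      · obtain rfl : k = n + 1 := by omega
        rw [hY]
        exact Finset.mem_compl.1 h
      · exact H k h1 hk
    · have : {Y : ℕ → E | (∀ k, 1 ≤ k → k ≤ n + 1 → Y k ∉ F) ∧ Y (n + 1) = ζ} = ∅ := by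
        refine Set.eq_empty_of_forall_notMem fun Y hY => h (Finset.mem_compl.2 ?_)
        rw [← hY.2]
        exact hY.1 (n + 1) (by omega) le_rfl
      rw [this, measureReal_empty]
  simp only [avoidProb_markov R F η (n + 1), h1, ite_mul, zero_mul, Finset.sum_ite_mem,
    Finset.univ_inter, Finset.sum_mul, jumpMean, Finset.mul_sum]
  rw [Finset.sum_comm]
  exact Finset.sum_congr rfl fun _ _ => Finset.sum_congr rfl fun _ _ => by ring

end RateMatrix

namespace RateMatrix

open Filter Topology

variable {E : Type*} [Fintype E] [DecidableEq E] [MeasurableSpace E] [MeasurableSingletonClass E]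

theorem avoidProb_nonneg (R : RateMatrix E) (F : Finset E) (η : E) (n : ℕ) (ξ : E) :
    0 ≤ R.avoidProb F η n ξ := measureReal_nonneg

theorem avoidProb_le_one (R : RateMatrix E) (F : Finset E) (η : E) (n : ℕ) (ξ : E) :
    R.avoidProb F η n ξ ≤ 1 := measureReal_le_one

/-- A solution `w` of `L w = -1` off `F` that vanishes on `F` is a Lyapunov function: it forces
the chain to leave the complement of `F`. -/
theorem tendsto_avoidProb {R : RateMatrix E} {μ : E → ℝ} (hμ : R.IsStationary μ)
    (hR : R.Irreducible) (hpos : ∀ η, 0 < R.hold η) {F : Finset E} (hF : F.Nonempty) (η : E)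
    {ζ : E} (hζ : ζ ∉ F) : Tendsto (fun n => R.avoidProb F η n ζ) atTop (𝓝 0) := by
  obtain ⟨w, ⟨hw0, -⟩, hw⟩ := hμ.exists_dirichlet hR hF ∅ 0
    (∑ η, μ η • (LinearMap.proj η : (E → ℝ) →ₗ[ℝ] ℝ))
  have hgen : ∀ ξ ∉ F, R.gen w ξ = -1 := fun ξ hξ =>
    hμ.gen_eq_of_weak hR (B := ∅) (ψ := 1) (fun v hv => by rw [hw v hv]; simp [scal]) hξ
      (Finset.notMem_empty ξ)
  have hw0' : ∀ ξ ∈ F, w ξ = 0 := fun ξ hξ => by simpa using hw0 ξ hξ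
  set M : ℕ → ℝ := fun n => ∑ ξ ∈ Fᶜ, R.avoidProb F η n ξ * (R.hold ξ)⁻¹ with hM
  set W : ℕ → ℝ := fun n => ∑ ξ, R.avoidProb F η n ξ * w ξ with hW
  have hWM : ∀ n, M n = W n - W (n + 1) := fun n => by
    have h1 : W n = ∑ ξ ∈ Fᶜ, R.avoidProb F η n ξ * w ξ := by
      refine (Finset.sum_subset (Finset.subset_univ _) fun ξ _ hξ => ?_).symm
      rw [hw0' ξ (by simpa using hξ), mul_zero]
    rw [h1, hW]
    dsimp only
    rw [sum_avoidProb_succ, ← Finset.sum_sub_distrib]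
    refine Finset.sum_congr rfl fun ξ hξ => ?_
    have h2 := hold_mul_jumpMean (hpos ξ) w
    rw [hgen ξ (Finset.mem_compl.1 hξ)] at h2
    have h3 : R.jumpMean w ξ = w ξ - (R.hold ξ)⁻¹ := by
      have := (hpos ξ).ne'
      field_simp
      linarith
    rw [h3]
    ring
  have hWb : ∀ n, |W n| ≤ ∑ ξ, |w ξ| := fun n =>
    (Finset.abs_sum_le_sum_abs _ _).trans (Finset.sum_le_sum fun ξ _ => by
      rw [abs_mul, abs_of_nonneg (R.avoidProb_nonneg F η n ξ)]
      exact mul_le_of_le_one_left (abs_nonneg _) (R.avoidProb_le_one F η n ξ))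
  have hterm : ∀ n ξ, 0 ≤ R.avoidProb F η n ξ * (R.hold ξ)⁻¹ := fun n ξ =>
    mul_nonneg (R.avoidProb_nonneg F η n ξ) (inv_nonneg.2 (hpos ξ).le)
  have hsum : Summable M := by
    refine summable_of_sum_range_le (c := 2 * ∑ ξ, |w ξ|)
      (fun n => Finset.sum_nonneg fun ξ _ => hterm n ξ) fun N => ?_
    simp only [hWM, Finset.sum_range_sub']
    linarith [abs_le.1 (hWb 0), abs_le.1 (hWb N)]
  have hlim : Tendsto (fun n => R.avoidProb F η n ζ * (R.hold ζ)⁻¹) atTop (𝓝 0) :=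
    squeeze_zero (fun n => hterm n ζ) (fun n => Finset.single_le_sum
      (f := fun ξ => R.avoidProb F η n ξ * (R.hold ξ)⁻¹) (fun ξ _ => hterm n ξ)
      (Finset.mem_compl.2 hζ)) hsum.tendsto_atTop_zero
  simpa [(hpos ζ).ne'] using hlim.mul_const (R.hold ζ)

/-- The probability that the jump chain started at `η` first returns to `F` at `ξ`. -/
noncomputable def returnProb (R : RateMatrix E) (F : Finset E) (η ξ : E) : ℝ :=
  (R.chainLaw η).real (returnTo F ξ)

theorem hasSum_avoidProb (R : RateMatrix E) {F : Finset E} (η : E) {ξ : E} (hξ : ξ ∈ F) :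
    HasSum (fun n => R.avoidProb F η n ξ) (R.returnProb F η ξ) := by
  have h1 : ∀ n, R.avoidProb F η n ξ
      = ((R.chainLaw η) (returnAt F n ∩ {Y | Y (n + 1) = ξ})).toReal := fun n => by
    rw [avoidProb, measureReal_def]
    congr 2
    ext Y
    refine ⟨fun h => ⟨⟨h.1, ?_⟩, h.2⟩, fun h => ⟨h.1.1, h.2⟩⟩
    rw [h.2]
    exact hξ
  have h2 : (R.chainLaw η) (returnTo F ξ)
      = ∑' n, (R.chainLaw η) (returnAt F n ∩ {Y | Y (n + 1) = ξ}) :=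
    measure_iUnion (fun m n h => (disjoint_returnAt F h).mono Set.inter_subset_left
      Set.inter_subset_left) fun n => (measurableSet_returnAt F n).inter
    (measurableSet_eq_fun (measurable_pi_apply (n + 1)) measurable_const)
  simp only [h1, returnProb, measureReal_def, h2]
  rw [ENNReal.tsum_toReal_eq fun _ => measure_ne_top _ _]
  exact (ENNReal.summable_toReal (h2 ▸ measure_ne_top _ _)).hasSum

/-- Optional stopping: if `L u = 0` off `F`, then the expectation of `u` at the first return to
`F` is its expectation after one jump. -/
theorem sum_returnProb {R : RateMatrix E} {μ : E → ℝ} (hμ : R.IsStationary μ)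
    (hR : R.Irreducible) (hpos : ∀ η, 0 < R.hold η) {F : Finset E} (hF : F.Nonempty) (η : E)
    {u : E → ℝ} (hu : ∀ ξ ∉ F, R.gen u ξ = 0) :
    ∑ ξ ∈ F, R.returnProb F η ξ * u ξ = R.jumpMean u η := by
  have hstep : ∀ N, ∑ n ∈ Finset.range (N + 1), ∑ ξ ∈ F, R.avoidProb F η n ξ * u ξ
      = R.jumpMean u η - ∑ ξ ∈ Fᶜ, R.avoidProb F η N ξ * u ξ := fun N => by
    induction N with
    | zero =>
      rw [← R.sum_avoidProb_zero F, ← Finset.sum_add_sum_compl F]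
      simp
    | succ N ih =>
      have h1 := R.sum_avoidProb_succ F η N u
      have h2 : ∑ ξ ∈ Fᶜ, R.avoidProb F η N ξ * R.jumpMean u ξ
          = ∑ ξ ∈ Fᶜ, R.avoidProb F η N ξ * u ξ := Finset.sum_congr rfl fun ξ hξ => by
        have h3 := hold_mul_jumpMean (hpos ξ) u
        rw [hu ξ (Finset.mem_compl.1 hξ), zero_add] at h3
        rw [mul_left_cancel₀ (hpos ξ).ne' h3]
      rw [h2, ← Finset.sum_add_sum_compl F] at h1
      rw [Finset.sum_range_succ, ih]
      linarith
  have hlim1 : Tendsto (fun N => R.jumpMean u η - ∑ ξ ∈ Fᶜ, R.avoidProb F η N ξ * u ξ) atTop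
      (𝓝 (R.jumpMean u η)) := by
    have : Tendsto (fun N => ∑ ξ ∈ Fᶜ, R.avoidProb F η N ξ * u ξ) atTop
        (𝓝 (∑ ξ ∈ Fᶜ, 0 * u ξ)) := tendsto_finsetSum _ fun ξ hξ =>
      (tendsto_avoidProb hμ hR hpos hF η (Finset.mem_compl.1 hξ)).mul_const _
    simpa using this.const_sub (R.jumpMean u η)
  have hlim2 : Tendsto (fun N => ∑ n ∈ Finset.range (N + 1), ∑ ξ ∈ F, R.avoidProb F η n ξ * u ξ)
      atTop (𝓝 (∑ ξ ∈ F, R.returnProb F η ξ * u ξ)) :=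
    ((hasSum_sum fun ξ hξ => (R.hasSum_avoidProb η hξ).mul_right (u ξ)).tendsto_sum_nat).comp
      (tendsto_add_atTop_nat 1)
  simp only [hstep] at hlim2
  exact tendsto_nhds_unique hlim2 hlim1

theorem ae_mem_returnAt {R : RateMatrix E} {μ : E → ℝ} (hμ : R.IsStationary μ)
    (hR : R.Irreducible) (hpos : ∀ η, 0 < R.hold η) {F : Finset E} (hF : F.Nonempty) (η : E) :
    ∀ᵐ Y ∂(R.chainLaw η), ∃ n, Y ∈ returnAt F n := by
  have h1 : ∑ ξ ∈ F, R.returnProb F η ξ = 1 := by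
    have h2 : ∀ ζ, R.gen (fun _ => 1) ζ = 0 := fun ζ => by simp [gen]
    have h3 := sum_returnProb hμ hR hpos hF η (u := fun _ => 1) fun ξ _ => h2 ξ
    have h4 := hold_mul_jumpMean (hpos η) (fun _ => 1)
    rw [h2, zero_add] at h4
    rw [mul_left_cancel₀ (hpos η).ne' h4] at h3
    simpa using h3
  have hdisj : (F : Set E).PairwiseDisjoint (returnTo F) := fun ξ _ ζ _ hne => by
    refine Set.disjoint_left.2 fun Y h h' => hne ?_
    obtain ⟨m, hm, hm'⟩ := Set.mem_iUnion.1 h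
    obtain ⟨n, hn, hn'⟩ := Set.mem_iUnion.1 h'
    obtain rfl : m = n := by
      by_contra hmn
      exact Set.disjoint_left.1 (disjoint_returnAt F hmn) hm hn
    exact hm'.symm.trans hn'
  have h5 : (R.chainLaw η).real (⋃ ξ ∈ F, returnTo F ξ) = 1 := by
    rw [measureReal_biUnion_finset hdisj fun ξ _ => measurableSet_returnTo F ξ]
    exact h1
  have h6 : ∀ᵐ Y ∂(R.chainLaw η), Y ∈ ⋃ ξ ∈ F, returnTo F ξ := by
    refine (mem_ae_iff_prob_eq_one (F.measurableSet_biUnion fun ξ _ =>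
      measurableSet_returnTo F ξ)).2 ?_
    rw [measureReal_def] at h5
    exact (ENNReal.toReal_eq_one_iff _).1 h5
  filter_upwards [h6] with Y hY
  obtain ⟨ξ, -, h⟩ := Set.mem_iUnion₂.1 hY
  obtain ⟨n, hn, -⟩ := Set.mem_iUnion.1 h
  exact ⟨n, hn⟩

end RateMatrix

/-! ### The holding times -/

theorem expMeasure_Iic {a : ℝ} (ha : 0 ≤ a) :
    expMeasure 1 (Set.Iic a) = ENNReal.ofReal (1 - Real.exp (-a)) := by
  have := isProbabilityMeasure_expMeasure zero_lt_one
  rw [← ofReal_cdf, cdf_expMeasure_eq zero_lt_one, if_pos ha, one_mul]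

theorem expMeasure_Iic_le {a : ℝ} (ha : 0 ≤ a) :
    expMeasure 1 (Set.Iic a) ≤ ENNReal.ofReal a := by
  rw [expMeasure_Iic ha]
  exact ENNReal.ofReal_le_ofReal (by linarith [Real.add_one_le_exp (-a)])

/-- The law of the sequence of independent exponential variables of mean one. -/
noncomputable def expSeqLaw : Measure (ℕ → ℝ) := Measure.infinitePi fun _ => expMeasure 1

instance : IsProbabilityMeasure expSeqLaw := by
  have := isProbabilityMeasure_expMeasure zero_lt_one
  unfold expSeqLaw
  infer_instance

theorem expSeqLaw_preimage (k : ℕ) {s : Set ℝ} (hs : MeasurableSet s) :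
    expSeqLaw ((fun e => e k) ⁻¹' s) = expMeasure 1 s := by
  have := isProbabilityMeasure_expMeasure zero_lt_one
  exact (measurePreserving_eval_infinitePi (fun _ : ℕ => expMeasure 1) k).measure_preimage
    hs.nullMeasurableSet

theorem expSeqLaw_preimage_inter {k l : ℕ} (hkl : k ≠ l) {s t : Set ℝ} (hs : MeasurableSet s)
    (ht : MeasurableSet t) : expSeqLaw ((fun e => e k) ⁻¹' s ∩ (fun e => e l) ⁻¹' t)
      = expMeasure 1 s * expMeasure 1 t := by
  have := isProbabilityMeasure_expMeasure zero_lt_one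
  have h1 : (fun e : ℕ → ℝ => e k) ⁻¹' s ∩ (fun e => e l) ⁻¹' t
      = Set.pi ({k, l} : Finset ℕ) (fun i => if i = k then s else t) := by
    ext e
    simp [Set.pi, hkl.symm]
  rw [h1, expSeqLaw, Measure.infinitePi_pi, Finset.prod_pair hkl, if_pos rfl, if_neg hkl.symm]
  intro i _
  split_ifs
  exacts [hs, ht]

theorem ae_expSeqLaw_pos : ∀ᵐ e ∂expSeqLaw, ∀ k, 0 < e k := by
  refine ae_all_iff.2 fun k => ?_
  have h1 : expSeqLaw ((fun e => e k) ⁻¹' Set.Iic 0) = 0 := by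
    rw [expSeqLaw_preimage k measurableSet_Iic, expMeasure_Iic le_rfl]
    simp
  refine measure_mono_null (fun e he => ?_) h1
  exact not_lt.1 (show ¬ 0 < e k from he)

/-! ### The jump rates of the trace -/

namespace RateMatrix

open Filter Topology

variable {E : Type*} [Fintype E] [DecidableEq E] [MeasurableSpace E] [MeasurableSingletonClass E]

theorem pathLaw_eq_prod (R : RateMatrix E) (η : E) :
    R.pathLaw η = (R.chainLaw η).prod expSeqLaw := rfl

instance (R : RateMatrix E) (η : E) : IsProbabilityMeasure (R.pathLaw η) := by
  rw [pathLaw_eq_prod]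
  infer_instance

/-- The event that the clock started at `η` and the one at the first return to `F` both ring
early: the holding variables are at most `a` and `b`. -/
def twoEarly (F : Finset E) (a b : ℝ) : Set ((ℕ → E) × (ℕ → ℝ)) :=
  ⋃ n, returnAt F n ×ˢ ((fun e => e 0) ⁻¹' Set.Iic a ∩ (fun e => e (n + 1)) ⁻¹' Set.Iic b)

theorem pathLaw_twoEarly_le (R : RateMatrix E) (F : Finset E) (η : E) {a b : ℝ} (ha : 0 ≤ a)
    (hb : 0 ≤ b) : (R.pathLaw η).real (twoEarly F a b) ≤ a * b := by
  refine ENNReal.toReal_le_of_le_ofReal (mul_nonneg ha hb) ?_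
  calc R.pathLaw η (twoEarly F a b)
      ≤ ∑' n, R.pathLaw η (returnAt F n ×ˢ
          ((fun e => e 0) ⁻¹' Set.Iic a ∩ (fun e => e (n + 1)) ⁻¹' Set.Iic b)) :=
        measure_iUnion_le _
    _ ≤ ∑' n, R.chainLaw η (returnAt F n) * ENNReal.ofReal (a * b) := by
        refine ENNReal.tsum_le_tsum fun n => ?_
        rw [pathLaw_eq_prod, Measure.prod_prod,
          expSeqLaw_preimage_inter (Nat.succ_ne_zero n).symm measurableSet_Iic measurableSet_Iic,
          ENNReal.ofReal_mul ha]
        gcongr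
        exacts [expMeasure_Iic_le ha, expMeasure_Iic_le hb]
    _ = R.chainLaw η (⋃ n, returnAt F n) * ENNReal.ofReal (a * b) := by
        rw [ENNReal.tsum_mul_right, measure_iUnion (disjoint_returnAt F) (measurableSet_returnAt F)]
    _ ≤ ENNReal.ofReal (a * b) := mul_le_of_le_one_left zero_le prob_le_one

/-- Up to an event of probability `O(t ^ 2)`, the trace is at `ξ ≠ η` at time `t` if and only if
the first holding time is at most `t` and the first return to `F` takes place at `ξ`. -/
theorem abs_traceProb_sub_le {R : RateMatrix E} {μ : E → ℝ} (hμ : R.IsStationary μ)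
    (hR : R.Irreducible) (hpos : ∀ η, 0 < R.hold η) {F : Finset E} {η ξ : E} (hη : η ∈ F)
    (hne : η ≠ ξ) {t : ℝ} (ht : 0 ≤ t) :
    |R.traceProb F η ξ t - R.returnProb F η ξ * (1 - Real.exp (-(R.hold η * t)))|
      ≤ R.hold η * (∑ ζ, R.hold ζ) * t ^ 2 := by
  set Λ := ∑ ζ, R.hold ζ
  have hΛ : ∀ ζ, R.hold ζ ≤ Λ := fun ζ =>
    Finset.single_le_sum (fun ζ _ => (hpos ζ).le) (Finset.mem_univ ζ)
  have hηt : 0 ≤ R.hold η * t := mul_nonneg (hpos η).le ht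
  have hΛt : 0 ≤ Λ * t := mul_nonneg ((hpos η).le.trans (hΛ η)) ht
  set G : Set ((ℕ → E) × (ℕ → ℝ)) :=
    returnTo F ξ ×ˢ ((fun e => e 0) ⁻¹' Set.Iic (R.hold η * t)) with hG
  set T : Set ((ℕ → E) × (ℕ → ℝ)) := {ω | R.trace F ω t = ξ} with hT
  set D := twoEarly F (R.hold η * t) (Λ * t) with hD
  have hGm : (R.pathLaw η).real G
      = R.returnProb F η ξ * (1 - Real.exp (-(R.hold η * t))) := by
    rw [measureReal_def, pathLaw_eq_prod, hG, Measure.prod_prod,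
      expSeqLaw_preimage 0 measurableSet_Iic, expMeasure_Iic hηt, ENNReal.toReal_mul,
      ENNReal.toReal_ofReal]
    · rfl
    · simpa using hηt
  have hDm : (R.pathLaw η).real D ≤ R.hold η * Λ * t ^ 2 :=
    (R.pathLaw_twoEarly_le F η hηt hΛt).trans_eq (by ring)
  -- outside the exceptional event the trace is known at time `t`
  have hae : ∀ᵐ ω ∂(R.pathLaw η), ω ∉ D → (ω ∈ T ↔ ω ∈ G) := by
    have h1 : ∀ᵐ ω ∂(R.pathLaw η), ω.1 0 = η ∧ ∃ n, ω.1 ∈ returnAt F n := by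
      rw [pathLaw_eq_prod]
      exact Measure.quasiMeasurePreserving_fst.ae
        ((R.ae_chainLaw_zero η).and (ae_mem_returnAt hμ hR hpos ⟨η, hη⟩ η))
    have h2 : ∀ᵐ ω ∂(R.pathLaw η), ∀ k, 0 < ω.2 k := by
      rw [pathLaw_eq_prod]
      exact Measure.quasiMeasurePreserving_snd.ae ae_expSeqLaw_pos
    filter_upwards [h1, h2] with ω ⟨h0, n, hn⟩ hω hωD
    have h0F : ω.1 0 ∈ F := h0 ▸ hη
    rcases le_or_gt (ω.2 0) (R.hold η * t) with hle | hlt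
    · have hbig : Λ * t < ω.2 (n + 1) := by
        by_contra! h
        exact hωD (Set.mem_iUnion.2 ⟨n, hn, hle, h⟩)
      have htr : R.trace F ω t = ω.1 (n + 1) := by
        refine trace_eq_return hpos hω h0F hn ?_ ?_
        · rw [h0, div_le_iff₀ (hpos η)]
          linarith
        · have h3 : t < ω.2 (n + 1) / R.hold (ω.1 (n + 1)) := by
            rw [lt_div_iff₀ (hpos _)]
            nlinarith [hΛ (ω.1 (n + 1))]
          have := div_pos (hω 0) (hpos (ω.1 0))
          linarith
      have hTo : ω.1 ∈ returnTo F ξ ↔ ω.1 (n + 1) = ξ := by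
        refine ⟨fun h => ?_, fun h => Set.mem_iUnion.2 ⟨n, hn, h⟩⟩
        obtain ⟨m, hm, hm'⟩ := Set.mem_iUnion.1 h
        obtain rfl : m = n := by
          by_contra hmn
          exact Set.disjoint_left.1 (disjoint_returnAt F hmn) hm hn
        exact hm'
      exact ⟨fun h => ⟨hTo.2 (htr.symm.trans h), hle⟩, fun h => htr.trans (hTo.1 h.1)⟩
    · have htr : R.trace F ω t = η := by
        rw [trace_eq_start hpos hω h0F ht, h0]
        rw [h0, lt_div_iff₀ (hpos η)]
        linarith
      exact ⟨fun h => absurd (htr.symm.trans h) hne, fun h => absurd h.2 (not_le.2 hlt)⟩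
  have hle : ∀ A A' : Set ((ℕ → E) × (ℕ → ℝ)), (∀ᵐ ω ∂(R.pathLaw η), ω ∉ D → ω ∈ A → ω ∈ A') →
      (R.pathLaw η).real A ≤ (R.pathLaw η).real A' + (R.pathLaw η).real D := fun A A' h =>
    (ENNReal.toReal_mono (measure_ne_top _ _) (measure_mono_ae (t := A' ∪ D) (by
      filter_upwards [h] with ω hω hA
      by_cases hωD : ω ∈ D
      · exact Or.inr hωD
      · exact Or.inl (hω hωD hA)))).trans (measureReal_union_le _ _)
  have h1 := hle T G (hae.mono fun ω h hω => (h hω).1)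
  have h2 := hle G T (hae.mono fun ω h hω => (h hω).2)
  rw [hGm] at h1 h2
  have hTP : R.traceProb F η ξ t = (R.pathLaw η).real T := rfl
  rw [hTP, abs_le]
  constructor <;> linarith

theorem hasDerivWithinAt_traceProb {R : RateMatrix E} {μ : E → ℝ} (hμ : R.IsStationary μ)
    (hR : R.Irreducible) (hpos : ∀ η, 0 < R.hold η) {F : Finset E} {η ξ : E} (hη : η ∈ F)
    (hne : η ≠ ξ) :
    HasDerivWithinAt (R.traceProb F η ξ) (R.hold η * R.returnProb F η ξ) (Set.Ici 0) 0 := by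
  set g : ℝ → ℝ := fun t => R.returnProb F η ξ * (1 - Real.exp (-(R.hold η * t))) with hg
  have hg' : HasDerivAt g (R.hold η * R.returnProb F η ξ) 0 := by
    have h1 : HasDerivAt (fun t : ℝ => -(R.hold η * t)) (-(R.hold η * 1)) 0 :=
      ((hasDerivAt_id (0 : ℝ)).const_mul (R.hold η)).neg
    have h2 := (h1.exp.const_sub 1).const_mul (R.returnProb F η ξ)
    convert! h2 using 1
    simp [mul_comm]
  have hd : HasDerivWithinAt (fun t => R.traceProb F η ξ t - g t) 0 (Set.Ici 0) 0 := by
    have hb := fun {t : ℝ} => abs_traceProb_sub_le hμ hR hpos hη hne (t := t)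
    have h0 : R.traceProb F η ξ 0 - g 0 = 0 := by simpa [hg] using hb le_rfl
    rw [hasDerivWithinAt_iff_isLittleO, h0]
    have hO : (fun t => R.traceProb F η ξ t - g t) =O[𝓝[Set.Ici 0] (0 : ℝ)] fun t => t ^ 2 := by
      refine Asymptotics.IsBigO.of_bound (R.hold η * ∑ ζ, R.hold ζ) ?_
      filter_upwards [self_mem_nhdsWithin] with t ht
      rw [Real.norm_eq_abs, Real.norm_eq_abs, abs_of_nonneg (sq_nonneg t)]
      exact hb ht
    have ho : (fun t : ℝ => t ^ 2) =o[𝓝[Set.Ici 0] (0 : ℝ)] fun t => t :=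
      (Asymptotics.isLittleO_pow_id (by norm_num : 1 < 2)).mono nhdsWithin_le_nhds
    simpa using hO.trans_isLittleO ho
  have := hd.add hg'.hasDerivWithinAt
  rw [zero_add] at this
  exact this.congr_of_mem (fun t _ => by simp) Set.self_mem_Ici

theorem traceRate_eq {R : RateMatrix E} {μ : E → ℝ} (hμ : R.IsStationary μ)
    (hR : R.Irreducible) (hpos : ∀ η, 0 < R.hold η) {F : Finset E} {η ξ : E} (hη : η ∈ F)
    (hne : η ≠ ξ) : R.traceRate F η ξ = R.hold η * R.returnProb F η ξ :=
  (hasDerivWithinAt_traceProb hμ hR hpos hη hne).derivWithin (uniqueDiffOn_Ici 0 0 Set.self_mem_Ici)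

/-- The generator of the trace: on functions `u` with `L u = 0` off `F` it coincides with `L`. -/
theorem gen_eq_sum_traceRate {R : RateMatrix E} {μ : E → ℝ} (hμ : R.IsStationary μ)
    (hR : R.Irreducible) (hpos : ∀ η, 0 < R.hold η) {F : Finset E} {η : E} (hη : η ∈ F)
    {u : E → ℝ} (hu : ∀ ξ ∉ F, R.gen u ξ = 0) :
    R.gen u η = ∑ ξ ∈ F, R.traceRate F η ξ * (u ξ - u η) := by
  -- subtracting the constant `u η` removes the diagonal term
  have hshift : ∀ ζ, R.gen (fun ξ => u ξ - u η) ζ = R.gen u ζ := fun ζ => by simp [gen]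
  have h1 := sum_returnProb hμ hR hpos ⟨η, hη⟩ η (u := fun ξ => u ξ - u η)
    fun ξ hξ => (hshift ξ).trans (hu ξ hξ)
  have h2 := hold_mul_jumpMean (hpos η) (fun ξ => u ξ - u η)
  rw [hshift, sub_self, mul_zero, add_zero] at h2
  rw [← h2, ← h1, Finset.mul_sum]
  refine Finset.sum_congr rfl fun ξ _ => ?_
  rcases eq_or_ne η ξ with rfl | hne
  · simp
  · rw [traceRate_eq hμ hR hpos hη hne, mul_assoc]

end RateMatrix

/-! ### The flux out of `B` -/

namespace RateMatrix

variable {E : Type*} [Fintype E] [DecidableEq E] [MeasurableSpace E] [MeasurableSingletonClass E]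

theorem meanRate_empty (R : RateMatrix E) (μ : E → ℝ) (F A : Finset E) :
    R.meanRate μ F A ∅ = 0 := by
  simp [meanRate]

theorem meanRate_union (R : RateMatrix E) (μ : E → ℝ) (F A : Finset E) {D D' : Finset E}
    (h : Disjoint D D') :
    R.meanRate μ F A (D ∪ D') = R.meanRate μ F A D + R.meanRate μ F A D' := by
  simp only [meanRate, Finset.sum_union h, mul_add, Finset.sum_add_distrib]

theorem meanRate_biUnion (R : RateMatrix E) (μ : E → ℝ) (F A : Finset E) {ι : Type*}
    (s : Finset ι) (D : ι → Finset E) (h : (s : Set ι).PairwiseDisjoint D) :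
    R.meanRate μ F A (s.biUnion D) = ∑ i ∈ s, R.meanRate μ F A (D i) := by
  classical
  induction s using Finset.induction_on with
  | empty => simp [meanRate_empty]
  | insert i s hi ih =>
    rw [Finset.biUnion_insert, meanRate_union, ih (h.subset (by simp)), Finset.sum_insert hi]
    refine (Finset.disjoint_biUnion_right _ _ _).2 fun j hj => h (by simp) (by simp [hj]) ?_
    rintro rfl
    exact hi hj

/-- The flux out of `B` of a function `u` with `L u = 0` off `A₀ ∪ A₁ ∪ B` that is constant
on each of the three sets. -/
theorem IsStationary.sum_gen_eq_meanRate {R : RateMatrix E} {μ : E → ℝ} (hμ : R.IsStationary μ)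
    (hR : R.Irreducible) (hpos : ∀ η, 0 < R.hold η) {A₀ A₁ B : Finset E} (h01 : Disjoint A₀ A₁)
    (h0B : Disjoint A₀ B) (h1B : Disjoint A₁ B) (hB : B.Nonempty) {u : E → ℝ}
    (hu : ∀ ξ ∉ A₀ ∪ A₁ ∪ B, R.gen u ξ = 0) {a₀ a₁ b : ℝ} (hu0 : ∀ η ∈ A₀, u η = a₀)
    (hu1 : ∀ η ∈ A₁, u η = a₁) (huB : ∀ η ∈ B, u η = b) :
    ∑ η ∈ B, μ η * R.gen u η = (∑ η ∈ B, μ η) *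
      (R.meanRate μ (A₀ ∪ A₁ ∪ B) B A₀ * (a₀ - b) + R.meanRate μ (A₀ ∪ A₁ ∪ B) B A₁ * (a₁ - b)) := by
  have h1 : ∀ η ∈ B, μ η * R.gen u η
      = μ η * (∑ ξ ∈ A₀, R.traceRate (A₀ ∪ A₁ ∪ B) η ξ) * (a₀ - b)
        + μ η * (∑ ξ ∈ A₁, R.traceRate (A₀ ∪ A₁ ∪ B) η ξ) * (a₁ - b) := fun η hη => by
    rw [gen_eq_sum_traceRate hμ hR hpos (Finset.mem_union_right _ hη) hu,
      Finset.sum_union (Finset.disjoint_union_left.2 ⟨h0B, h1B⟩), Finset.sum_union h01,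
      Finset.sum_congr rfl fun ξ hξ => by rw [hu0 ξ hξ, huB η hη],
      Finset.sum_congr (s₁ := A₁) rfl fun ξ hξ => by rw [hu1 ξ hξ, huB η hη],
      Finset.sum_congr (s₁ := B) rfl fun ξ hξ => by rw [huB ξ hξ, huB η hη, sub_self, mul_zero],
      Finset.sum_const_zero, ← Finset.sum_mul, ← Finset.sum_mul]
    ring
  have hB0 : (∑ η ∈ B, μ η) ≠ 0 := (Finset.sum_pos (fun η _ => hμ.pos hR η) hB).ne'
  rw [Finset.sum_congr rfl h1, Finset.sum_add_distrib, ← Finset.sum_mul, ← Finset.sum_mul,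
    meanRate, meanRate]
  field_simp

/-- The sum of the two rates is the Dirichlet form of the harmonic extension of `1_B`, divided by
`μ(B)`. -/
theorem IsStationary.meanRate_add_pos {R : RateMatrix E} {μ : E → ℝ} (hμ : R.IsStationary μ)
    (hR : R.Irreducible) (hpos : ∀ η, 0 < R.hold η) {A₀ A₁ B : Finset E} (h01 : Disjoint A₀ A₁)
    (h0B : Disjoint A₀ B) (h1B : Disjoint A₁ B) (h1 : A₁.Nonempty) (hB : B.Nonempty) :
    0 < R.meanRate μ (A₀ ∪ A₁ ∪ B) B A₀ + R.meanRate μ (A₀ ∪ A₁ ∪ B) B A₁ := by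
  obtain ⟨g, ⟨hg, -⟩, hw⟩ := hμ.exists_dirichlet hR (hB.mono Finset.subset_union_right :
    (A₀ ∪ A₁ ∪ B).Nonempty) ∅ (fun η => if η ∈ B then 1 else 0) 0
  have hg' : ∀ η ∈ A₀ ∪ A₁ ∪ B, g η = if η ∈ B then 1 else 0 := fun η hη =>
    sub_eq_zero.1 (hg η hη)
  have hg0 : ∀ η ∈ A₀, g η = 0 := fun η hη => by
    rw [hg' η (by simp [hη]), if_neg (Finset.disjoint_left.1 h0B hη)]
  have hg1 : ∀ η ∈ A₁, g η = 0 := fun η hη => by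
    rw [hg' η (by simp [hη]), if_neg (Finset.disjoint_left.1 h1B hη)]
  have hgB : ∀ η ∈ B, g η = 1 := fun η hη => by rw [hg' η (by simp [hη]), if_pos hη]
  have hgen : ∀ ξ ∉ A₀ ∪ A₁ ∪ B, R.gen g ξ = 0 := fun ξ hξ => by
    simpa using hμ.gen_eq_of_weak hR (B := ∅) (ψ := 0) (fun v hv => by rw [hw v hv]; simp [scal])
      hξ (Finset.notMem_empty ξ)
  have hform : R.form μ g g = -∑ η ∈ B, μ η * R.gen g η := by
    rw [form_apply, ← Finset.sum_neg_distrib, ← Finset.sum_subset (Finset.subset_univ B)]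
    · exact Finset.sum_congr rfl fun η hη => by rw [hgB η hη]; ring
    · intro η _ hη
      by_cases hF : η ∈ A₀ ∪ A₁ ∪ B
      · rw [hg' η hF, if_neg hη]
        ring
      · rw [hgen η hF]
        ring
  have hne : R.form μ g g ≠ 0 := fun h => by
    obtain ⟨α, hα⟩ := h1
    obtain ⟨β, hβ⟩ := hB
    have := hμ.eq_of_form_self_eq_zero hR h α β
    rw [hg1 α hα, hgB β hβ] at this
    exact zero_ne_one this
  have hfpos := (hμ.form_self_nonneg g).lt_of_ne hne.symm
  rw [hform, hμ.sum_gen_eq_meanRate hR hpos h01 h0B h1B hB hgen hg0 hg1 hgB] at hfpos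
  have hBpos : 0 < ∑ η ∈ B, μ η := Finset.sum_pos (fun η _ => hμ.pos hR η) hB
  refine pos_of_mul_pos_right (a := ∑ η ∈ B, μ η) ?_ hBpos.le
  linarith

/-- The three statements for disjoint sets `A₀`, `A₁`, `B`: positivity of the denominator, an
optimal pair with the asserted value on `B`, and its uniqueness. -/
theorem IsStationary.optimalPair {R : RateMatrix E} {μ : E → ℝ} (hμ : R.IsStationary μ)
    (hR : R.Irreducible) (hpos : ∀ η, 0 < R.hold η) {A₀ A₁ B : Finset E} (h01 : Disjoint A₀ A₁)
    (h0B : Disjoint A₀ B) (h1B : Disjoint A₁ B) (h1 : A₁.Nonempty) (hB : B.Nonempty) :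
    (∃ f h, IsOptimalPair (energy R μ) (classF A₀ A₁ B) (classH A₀ A₁ B) f h ∧
      ∀ η ∈ B, h η = R.meanRate μ (A₀ ∪ A₁ ∪ B) B A₁ /
        (R.meanRate μ (A₀ ∪ A₁ ∪ B) B A₀ + R.meanRate μ (A₀ ∪ A₁ ∪ B) B A₁)) ∧
    (A₀.Nonempty → ∀ f h f' h',
      IsOptimalPair (energy R μ) (classF A₀ A₁ B) (classH A₀ A₁ B) f h →
      IsOptimalPair (energy R μ) (classF A₀ A₁ B) (classH A₀ A₁ B) f' h' → f' = f ∧ h' = h) := by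
  obtain ⟨f, u, hf, hu, hw, hfu⟩ := hμ.exists_saddle hR (B := B) h01 h1B h1
  refine ⟨⟨f, u, hμ.isOptimalPair_saddle hf hu hw hfu, fun η hη => ?_⟩,
    fun h0 f₁ h₁ f₂ h₂ ho₁ ho₂ => ?_⟩
  · obtain ⟨b, hb⟩ := hu.2.2
    have hgen : ∀ ξ ∉ A₀ ∪ A₁ ∪ B, R.gen u ξ = 0 := fun ξ hξ => by
      simp only [Finset.mem_union, not_or] at hξ
      simpa using hμ.gen_eq_of_weak hR (Z := A₀ ∪ A₁) (B := B) (ψ := 0)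
        (fun v hv => by rw [hw v hv]; simp [scal]) (by simp [hξ]) hξ.2
    -- the flux of `u` out of `B` vanishes, which determines its value there
    have hflux := sum_gen_eq_zero_of_weak (Finset.disjoint_union_left.2 ⟨h0B, h1B⟩) hw
    rw [hμ.sum_gen_eq_meanRate hR hpos h01 h0B h1B hB hgen hu.2.1 hu.1 hb] at hflux
    have hBpos : 0 < ∑ η ∈ B, μ η := Finset.sum_pos (fun η _ => hμ.pos hR η) hB
    have h2 := (mul_eq_zero.1 hflux).resolve_left hBpos.ne'
    rw [hb η hη, eq_div_iff (hμ.meanRate_add_pos hR hpos h01 h0B h1B h1 hB).ne']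
    linarith
  · obtain ⟨e1, e2⟩ := hμ.optimalPair_unique hR h0 hf hu hw hfu ho₁
    obtain ⟨e3, e4⟩ := hμ.optimalPair_unique hR h0 hf hu hw hfu ho₂
    exact ⟨e3.trans e1.symm, e4.trans e2.symm⟩

end RateMatrix

theorem propositions02 {E : Type*} [Fintype E] [DecidableEq E] [MeasurableSpace E]
    [MeasurableSingletonClass E] (R : RateMatrix E) (hR : R.Irreducible)
    (μ : E → ℝ) (hμ : R.IsStationary μ) :
    -- the general result, for three disjoint sets
    (∀ A₀ A₁ B : Finset E, Disjoint A₀ A₁ → Disjoint A₀ B → Disjoint A₁ B →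
      A₁.Nonempty → B.Nonempty →
      -- the jump rates of the trace exist, and the denominator is not zero
      (∀ η ∈ A₀ ∪ A₁ ∪ B, ∀ ξ ∈ A₀ ∪ A₁ ∪ B, η ≠ ξ →
        DifferentiableWithinAt ℝ (R.traceProb (A₀ ∪ A₁ ∪ B) η ξ) (Set.Ici 0) 0) ∧
      0 < R.meanRate μ (A₀ ∪ A₁ ∪ B) B A₀ + R.meanRate μ (A₀ ∪ A₁ ∪ B) B A₁ ∧
      -- there is an optimal pair with the asserted value on `B`
      (∃ f h, IsOptimalPair (energy R μ) (classF A₀ A₁ B) (classH A₀ A₁ B) f h ∧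
        ∀ η ∈ B, h η = R.meanRate μ (A₀ ∪ A₁ ∪ B) B A₁ /
          (R.meanRate μ (A₀ ∪ A₁ ∪ B) B A₀ + R.meanRate μ (A₀ ∪ A₁ ∪ B) B A₁)) ∧
      -- and it is the only optimal pair
      (A₀.Nonempty → ∀ f h f' h',
        IsOptimalPair (energy R μ) (classF A₀ A₁ B) (classH A₀ A₁ B) f h →
        IsOptimalPair (energy R μ) (classF A₀ A₁ B) (classH A₀ A₁ B) f' h' →
        f' = f ∧ h' = h) ∧
      -- the other sign in front of the linear term replaces `h` by `-h`
      (∀ f h, IsOptimalPair (energyNeg R μ) (classF A₀ A₁ B) (classH A₀ A₁ B) f h ↔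
        IsOptimalPair (energy R μ) (classF A₀ A₁ B) (classH A₀ A₁ B) f (-h))) ∧
    -- the special case of wells `𝓔 1, …, 𝓔 κ`
    (∀ (κ : ℕ) (𝓔 : Fin κ → Finset E), 2 ≤ κ → (∀ z, (𝓔 z).Nonempty) →
      (∀ z w, z ≠ w → Disjoint (𝓔 z) (𝓔 w)) →
      ∀ x y : Fin κ, x ≠ y → ∀ U A₀ : Finset E, U = Finset.univ.biUnion 𝓔 →
      A₀ = U \ (𝓔 x ∪ 𝓔 y) →
      (∀ η ∈ U, ∀ ξ ∈ U, η ≠ ξ →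
        DifferentiableWithinAt ℝ (R.traceProb U η ξ) (Set.Ici 0) 0) ∧
      0 < ∑ z ∈ Finset.univ.erase x, R.meanRate μ U (𝓔 x) (𝓔 z) ∧
      (∃ f h, IsOptimalPair (energy R μ) (classF A₀ (𝓔 y) (𝓔 x)) (classH A₀ (𝓔 y) (𝓔 x)) f h ∧
        ∀ η ∈ 𝓔 x, h η = R.meanRate μ U (𝓔 x) (𝓔 y) /
          ∑ z ∈ Finset.univ.erase x, R.meanRate μ U (𝓔 x) (𝓔 z)) ∧
      (3 ≤ κ → ∀ f h f' h',
        IsOptimalPair (energy R μ) (classF A₀ (𝓔 y) (𝓔 x)) (classH A₀ (𝓔 y) (𝓔 x)) f h →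
        IsOptimalPair (energy R μ) (classF A₀ (𝓔 y) (𝓔 x)) (classH A₀ (𝓔 y) (𝓔 x)) f' h' →
        f' = f ∧ h' = h)) := by
  -- two disjoint non-empty sets exclude the chain with a single, absorbing state
  have hold_pos : ∀ A B : Finset E, Disjoint A B → A.Nonempty → B.Nonempty →
      ∀ η, 0 < R.hold η := by
    rintro A B hAB ⟨α, hα⟩ ⟨β, hβ⟩
    have : Nontrivial E := ⟨α, β, fun h => Finset.disjoint_left.1 hAB hα (h ▸ hβ)⟩
    exact hR.hold_pos
  refine ⟨fun A₀ A₁ B h01 h0B h1B h1 hB => ?_,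
    fun κ 𝓔 _ hne hdisj x y hxy U A₀ hU hA₀ => ?_⟩
  · have hpos := hold_pos A₁ B h1B h1 hB
    obtain ⟨hex, huniq⟩ := hμ.optimalPair hR hpos h01 h0B h1B h1 hB
    exact ⟨fun η hη ξ _ hne =>
        (RateMatrix.hasDerivWithinAt_traceProb hμ hR hpos hη hne).differentiableWithinAt,
      hμ.meanRate_add_pos hR hpos h01 h0B h1B h1 hB, hex, huniq,
      R.isOptimalPair_energyNeg_iff μ A₀ A₁ B⟩
  · have h1B : Disjoint (𝓔 y) (𝓔 x) := hdisj y x hxy.symm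
    have hsdiff : Disjoint A₀ (𝓔 x ∪ 𝓔 y) := hA₀ ▸ Finset.sdiff_disjoint
    obtain ⟨h0B, h01⟩ := Finset.disjoint_union_right.1 hsdiff
    have hsub : ∀ z, 𝓔 z ⊆ U := fun z => by
      rw [hU]
      exact Finset.subset_biUnion_of_mem 𝓔 (Finset.mem_univ z)
    have hUnion : A₀ ∪ 𝓔 y ∪ 𝓔 x = U := by
      rw [Finset.union_assoc, Finset.union_comm (𝓔 y), hA₀]
      exact Finset.sdiff_union_of_subset (Finset.union_subset (hsub x) (hsub y))
    have hA₀y : A₀ ∪ 𝓔 y = (Finset.univ.erase x).biUnion 𝓔 := by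
      ext η
      simp only [hA₀, hU, Finset.mem_union, Finset.mem_sdiff, Finset.mem_biUnion,
        Finset.mem_univ, true_and, Finset.mem_erase, and_true, not_or]
      constructor
      · rintro (⟨⟨z, hz⟩, hx, -⟩ | hy)
        · exact ⟨z, fun h => hx (h ▸ hz), hz⟩
        · exact ⟨y, hxy.symm, hy⟩
      · rintro ⟨z, hzx, hz⟩
        rcases eq_or_ne z y with rfl | hzy
        · exact Or.inr hz
        · exact Or.inl ⟨⟨z, hz⟩, Finset.disjoint_left.1 (hdisj z x hzx) hz,
            Finset.disjoint_left.1 (hdisj z y hzy) hz⟩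
    have hrate : ∑ z ∈ Finset.univ.erase x, R.meanRate μ U (𝓔 x) (𝓔 z)
        = R.meanRate μ U (𝓔 x) A₀ + R.meanRate μ U (𝓔 x) (𝓔 y) := by
      rw [← R.meanRate_union μ U (𝓔 x) h01, hA₀y, R.meanRate_biUnion]
      exact fun z _ w _ hzw => hdisj z w hzw
    have hpos := hold_pos (𝓔 y) (𝓔 x) h1B (hne y) (hne x)
    obtain ⟨hex, huniq⟩ := hμ.optimalPair hR hpos h01 h0B h1B (hne y) (hne x)
    have hden := hμ.meanRate_add_pos hR hpos h01 h0B h1B (hne y) (hne x)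
    rw [hUnion] at hex hden
    rw [hrate]
    refine ⟨fun η hη ξ _ hne =>
        (RateMatrix.hasDerivWithinAt_traceProb hμ hR hpos hη hne).differentiableWithinAt,
      hden, hex, fun hκ => huniq ?_⟩
    -- a third well makes `A₀` non-empty
    obtain ⟨z, hz⟩ : ∃ z, z ∉ ({x, y} : Finset (Fin κ)) := by
      by_contra! h
      have h1 := Finset.card_le_card (fun z _ => h z : Finset.univ ⊆ ({x, y} : Finset (Fin κ)))
      rw [Finset.card_univ, Fintype.card_fin] at h1
      exact absurd (h1.trans Finset.card_le_two) (by omega)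
    simp only [Finset.mem_insert, Finset.mem_singleton, not_or] at hz
    obtain ⟨η, hη⟩ := hne z
    refine ⟨η, ?_⟩
    rw [hA₀, Finset.mem_sdiff, Finset.mem_union, not_or]
    exact ⟨hsub z hη, Finset.disjoint_left.1 (hdisj z x hz.1) hη,
      Finset.disjoint_left.1 (hdisj z y hz.2) hη⟩
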